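/- Let $m\ge 1$, let $\|\cdot\|$ be the Hermitian norm on $\mathbb{C}^m$ (and the induced operator norm), and let $X$ be an analytic vector field on an open neighbourhood $U$ of $0$ in $\mathbb{C}^m$ with $X(0)=0$. Write, near $0$, $$X(x)=Lx+\sum_{\delta\ge 2}f_\delta(x,\dots,x),$$ where $L$ is linear and nilpotent and $f_\delta$ is a bounded symmetric $\delta$-linear map $(\mathbb{C}^m)^\delta\to\mathbb{C}^m$ with $$\|f_\delta(x_1,\dots,x_\delta)\|\le \frac{c\,\|x_1\|\cdots\|x_\delta\|}{\rho^\delta}\qquad(\delta\ge2),$$ with $c,\rho>0$ independent of $\delta$. Let $Q$ be an invertible linear map of $\mathbb{C}^m$ such that $N=QLQ^{-1}$ is a direct sum of standard nilpotent blocks: the coordinates are divided into groups $(x^j_1,\dots,x^j_{k_j+1})$, $1\le j\le n$, $k_j\ge 0$, $\sum_j(k_j+1)=m$, and $$N=\sum_{j=1}^n\sum_{i=1}^{k_j}\sqrt{i(k_j+1-i)}\;x^j_{i+1}\frac{\partial}{\partial x^j_i}.$$ Put $\nu=\sup_{p\ge1}\dfrac{e^2\,p!}{p^{p+1/2}e^{-p}}$,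 $$C=\frac{\sqrt m}{\rho^2}\Big\{\big(\tfrac52 m+2\big)c\,\|Q\|^2\|Q^{-1}\|^2+3\rho\,\|Q\|\,\|Q^{-1}\|\Big\},\qquad M_0=\frac{10}{9}\Big\{\nu\sqrt{\tfrac{27}{8e}}+(2e)^2\Big\},\qquad w=\frac1{eC},$$ $\bar L=Q^{-1}N^*Q$, where $N^*$ is the adjoint of $N$ for the Hermitian inner product, and, for $\varepsilon>0$, $p_{\rm opt}=p_{\rm opt}(\varepsilon)=\Big[\dfrac{1}{eC\varepsilon}\Big]$ (integer part). Then there are maps $u_p,R_p,T_p$ ($p\in\mathbb{N}$) such that for all sufficiently small $\varepsilon>0$ the following holds with $p=p_{\rm opt}(\varepsilon)$. The maps $u_p$ and $R_p$ are polynomial maps $\mathbb{C}^m\to\mathbb{C}^m$ whose monomials all have degree between $2$ and $p$. On some open ball around $0$ of radius larger than $\varepsilon$, the map $\mathrm{id}+u_p$ is injective with invertible derivative and takes its values in $U$, $T_p$ is analytic, and in the coordinates $y$ given by $x=y+u_p(y)$ the vector field $X$ becomes $Y=L+R_p+T_p$, i.e. $(\mathrm{id}+Du_p(y))\,Y(y)=X(y+u_p(y))$.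 Moreover $T_p(y)=O(\|y\|^{p+1})$ as $y\to0$, $$\sup_{\|y\|\le\varepsilon}\|T_p(y)\|\le M_0\,\varepsilon^2e^{-w/\varepsilon},$$ and $R_p(e^{t\bar L}y)=e^{t\bar L}R_p(y)$ for all $t\in\mathbb{C}$ and $y\in\mathbb{C}^m$. -/

import Mathlib

open Filter Topology

noncomputable section

namespace NilpotentNF

/-- `ℂ^m` with its Hermitian (Euclidean) norm. -/
abbrev Cspace (m : ℕ) : Type := EuclideanSpace ℂ (Fin m)

/-- The matrix of the linear vector field
`∑_{i=1}^{k} √(i (k + 1 - i)) x_{i+1} ∂/∂x_i` in the variables `x_1, …, x_{k+1}`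
(here the indices start at `0`; for `k = 0` it is the `1 × 1` zero matrix). -/
def nilBlock (k : ℕ) : Matrix (Fin (k + 1)) (Fin (k + 1)) ℂ :=
  Matrix.of fun i j =>
    if (j : ℕ) = (i : ℕ) + 1 then ((Real.sqrt (((i : ℝ) + 1) * ((k : ℝ) - (i : ℝ))) : ℝ) : ℂ)
    else 0

/-- `N` is the direct sum `N_{k_1}(x^1) + … + N_{k_n}(x^n)` of standard nilpotent blocks, the
coordinates of `ℂ^m` being grouped (through `e`) into `n` groups of sizes `k_i + 1`. -/
def IsStandardNilpotent {m : ℕ} (N : Cspace m →L[ℂ] Cspace m) : Prop :=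
  ∃ (n : ℕ) (k : Fin n → ℕ) (e : (Σ i : Fin n, Fin (k i + 1)) ≃ Fin m),
    N = Matrix.toEuclideanCLM (n := Fin m) (𝕜 := ℂ)
      (Matrix.reindex e e (Matrix.blockDiagonal' fun i => nilBlock (k i)))

/-- `u : ℂ^m → ℂ^m` is a polynomial map all of whose monomials have degree between `a` and `b`. -/
def IsPolyMap {m : ℕ} (a b : ℕ) (u : Cspace m → Cspace m) : Prop :=
  ∃ P : Fin m → MvPolynomial (Fin m) ℂ,
    (∀ i, ∀ d ∈ (P i).support, a ≤ d.degree ∧ d.degree ≤ b) ∧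
    ∀ x i, u x i = MvPolynomial.eval (fun j => x j) (P i)

/-- `ν = sup_{p ≥ 1} e² p! / (p^{p + 1/2} e^{-p})`. -/
def nu : ℝ :=
  ⨆ p : ℕ+, Real.exp 2 * (Nat.factorial (p : ℕ) : ℝ) /
    (((p : ℕ) : ℝ) ^ (((p : ℕ) : ℝ) + 1 / 2) * Real.exp (-((p : ℕ) : ℝ)))

/-- `C = (√m / ρ²) { (5m/2 + 2) c q² q'² + 3 ρ q q' }`, where `q = ‖Q‖` and `q' = ‖Q⁻¹‖`. -/
def constC (m : ℕ) (c ρ q q' : ℝ) : ℝ :=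
  Real.sqrt m / ρ ^ 2 * ((5 / 2 * m + 2) * c * q ^ 2 * q' ^ 2 + 3 * ρ * q * q')

/-- `M₀ = (10/9) { ν √(27/(8e)) + (2e)² }`. -/
def constM0 : ℝ :=
  10 / 9 * (nu * Real.sqrt (27 / (8 * Real.exp 1)) + (2 * Real.exp 1) ^ 2)

end NilpotentNF

end

noncomputable section

namespace NilpotentNF

/-! ### A spectral gap for operators with integral commutator -/

section Gap

variable {W : Type*} [NormedAddCommGroup W] [InnerProductSpace ℂ W]

open scoped InnerProductSpace

/-! After conjugation by `Q` the linear part is the standard operator `N`, and the terms of degree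
`k` of the transformation and of the normal form solve the homological equation `DΦ(y) N y - N Φ(y)
+ R(y) = G(y)`, where `G` involves only lower degrees. On tensors with the Hilbert–Schmidt norm, the
operator `A` acting on `Φ` and its adjoint generate an `sl₂`-triple with integral weights. Hence the
eigenvalues of `A* A` are integers and `A` is bounded below by `1` on the orthogonal complement of
its kernel. So `Φ` and `R` can be chosen no larger than `G` in every degree, with `R` in the kernel
of the adjoint: there are no small divisors (`exists_homological_solution`,
`IsStandardNilpotent.exists_homological`).

The norms of the terms up to order `p` then obey an explicit nonlinear recursion, whose only loss is
the factor `l ≤ p` from differentiating a term of degree `l`. On a ball of radius `r = τ / p` this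
loss is harmless, since `p r³ = τ r²`, and the majorant closes for large `p` as soon as `4 m c a² τ
< 1` (`sum_majorant_le`, `eventually_majorant`). All that remains after truncation has degree
greater than `p`, so the remainder is at most `K (‖y‖ / r) ^ (p + 1)` with `K` independent of `p`
(`IsStandardNilpotent.exists_normalForm`).

The constant `C` leaves some slack: in the original coordinates the radius can be `11 / (10 C p)`,
which at the optimal order is at least `(11/10) e ε`. For `‖y‖ ≤ ε` the ratio is thus at most
`(10/11) e⁻¹`. The power of `e⁻¹` gives `exp (-w/ε)`, while `(10/11) ^ (p + 1)` beats every constant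
and the factor `ε⁻²`. Only the positivity of `M₀` matters. Finally, the adjoint kernel condition on
`R` integrates to equivariance under the flow. -/

theorem commutator_adjoint_relation {A B K : W →ₗ[ℂ] W}
    (hAB : ∀ x y, ⟪A x, y⟫_ℂ = ⟪x, B y⟫_ℂ)
    (hK : K = A * B - B * A) (hKA : K * A - A * K = (2 : ℂ) • A) :
    K * B - B * K = -((2 : ℂ) • B) := by
  have hBA : ∀ x y, ⟪B x, y⟫_ℂ = ⟪x, A y⟫_ℂ := fun x y => by
    rw [← inner_conj_symm, ← hAB, inner_conj_symm]
  have hKK : ∀ x y, ⟪K x, y⟫_ℂ = ⟪x, K y⟫_ℂ := fun x y => by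
    simp only [hK, LinearMap.sub_apply, Module.End.mul_apply, inner_sub_left, inner_sub_right,
      hAB, hBA]
  ext y
  refine ext_inner_left ℂ fun x => ?_
  have h := congrArg (fun F : W →ₗ[ℂ] W => ⟪F x, y⟫_ℂ) hKA
  simp only [LinearMap.sub_apply, Module.End.mul_apply, inner_sub_left, LinearMap.smul_apply,
    inner_smul_left, hAB, hKK, map_ofNat] at h
  simp only [LinearMap.sub_apply, Module.End.mul_apply, inner_sub_right, LinearMap.neg_apply,
    LinearMap.smul_apply, inner_neg_right, inner_smul_right]
  linear_combination -h

variable [FiniteDimensional ℂ W]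

/-- The usual `sl₂` ladder: on a common eigenvector of `B * A` and `K`, climbing with `A` shifts the
weight by `2` and lowers the eigenvalue of `B * A` by the new weight. The ladder stops in finite
dimension, and at its top `B * A` vanishes, which expresses `l` through the integral weight `k`. -/
theorem eigenvalue_adjoint_mul_self_integral {A B K : W →ₗ[ℂ] W}
    (hAB : ∀ x y, ⟪A x, y⟫_ℂ = ⟪x, B y⟫_ℂ)
    (hK : K = A * B - B * A) (hKA : K * A - A * K = (2 : ℂ) • A)
    (hKint : ∀ μ, Module.End.HasEigenvalue K μ → ∃ n : ℤ, μ = n)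
    {l : ℂ} (hl : Module.End.HasEigenvalue (B * A) l) : ∃ n : ℤ, l = n := by
  have hKB := commutator_adjoint_relation hAB hK hKA
  have e1 : ∀ x, K (A x) = A (K x) + (2 : ℂ) • A x := fun x => by
    have := congrArg (fun F : W →ₗ[ℂ] W => F x) hKA
    simp only [LinearMap.sub_apply, Module.End.mul_apply, LinearMap.smul_apply] at this
    rw [← this]; abel
  have e2 : ∀ x, K (B x) = B (K x) - (2 : ℂ) • B x := fun x => by
    have := congrArg (fun F : W →ₗ[ℂ] W => F x) hKB
    simp only [LinearMap.sub_apply, Module.End.mul_apply, LinearMap.smul_apply,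
      LinearMap.neg_apply] at this
    rw [sub_eq_add_neg, ← this]; abel
  have e3 : ∀ x, B (A x) = A (B x) - K x := fun x => by
    rw [hK]; simp
  have hcomm : ∀ x ∈ Module.End.eigenspace (B * A) l,
      K x ∈ Module.End.eigenspace (B * A) l := by
    intro x hx
    rw [Module.End.mem_eigenspace_iff] at hx ⊢
    have hx' : B (A x) = l • x := hx
    change B (A (K x)) = l • K x
    have h1 : K (B (A x)) = B (A (K x)) := by
      rw [e2, e1, map_add, map_smul]; abel
    rw [← h1, hx', map_smul]
  -- `K` commutes with `B * A`, so it has an eigenvector inside the eigenspace of `l`.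
  obtain ⟨v, k, hv0, hvS, hvK⟩ : ∃ (v : W) (k : ℂ), v ≠ 0 ∧ B (A v) = l • v ∧ K v = k • v := by
    have : Nontrivial (Module.End.eigenspace (B * A) l) := by
      rw [Submodule.nontrivial_iff_ne_bot]; exact hl
    obtain ⟨k, hk⟩ := Module.End.exists_eigenvalue (K.restrict hcomm)
    obtain ⟨v, hv⟩ := hk.exists_hasEigenvector
    refine ⟨v, k, ?_, ?_, ?_⟩
    · simpa using hv.2
    · simpa using Module.End.mem_eigenspace_iff.1 v.2
    · simpa using congrArg Subtype.val hv.apply_eq_smul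
  have hKj : ∀ j : ℕ, K ((A ^ j) v) = (k + 2 * j) • (A ^ j) v := by
    intro j
    induction j with
    | zero => simpa using hvK
    | succ j ih =>
      rw [pow_succ', Module.End.mul_apply, e1, ih, map_smul, ← add_smul]
      congr 1; push_cast; ring
  -- The subtracted number is the sum of the weights `k + 2 i` for `1 ≤ i ≤ j`.
  have hSj : ∀ j : ℕ, B (A ((A ^ j) v)) = (l - (j * k + j * (j + 1))) • (A ^ j) v := by
    intro j
    induction j with
    | zero => simpa using hvS
    | succ j ih =>
      have h1 : (A ^ (j + 1)) v = A ((A ^ j) v) := by rw [pow_succ', Module.End.mul_apply]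
      rw [e3, hKj, h1, ih, map_smul, ← sub_smul]
      congr 1; push_cast; ring
  obtain ⟨kz, hkz⟩ := hKint k (Module.End.hasEigenvalue_of_hasEigenvector
    (x := v) ⟨Module.End.mem_eigenspace_iff.2 hvK, hv0⟩)
  -- Otherwise `K` would have the infinitely many distinct eigenvalues `k + 2 j`.
  have hex : ∃ j : ℕ, (A ^ j) v = 0 := by
    by_contra hne
    push Not at hne
    have hinj : Function.Injective (fun j : ℕ => k + 2 * (j : ℂ)) := by
      intro i j hij
      simpa using hij
    refine Set.infinite_range_of_injective hinj
      ((Module.End.finite_hasEigenvalue K).subset ?_)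
    rintro _ ⟨j, rfl⟩
    exact Module.End.hasEigenvalue_of_hasEigenvector
      ⟨Module.End.mem_eigenspace_iff.2 (hKj j), hne j⟩
  classical
  obtain ⟨j, hj⟩ : ∃ j, Nat.find hex = j + 1 := by
    refine Nat.exists_eq_succ_of_ne_zero fun h0 => hv0 ?_
    simpa [h0] using Nat.find_spec hex
  have hjne : (A ^ j) v ≠ 0 := Nat.find_min hex (by omega)
  have hj1 : A ((A ^ j) v) = 0 := by
    rw [← Module.End.mul_apply, ← pow_succ', ← hj]; exact Nat.find_spec hex
  have h0 := hSj j
  rw [hj1, map_zero] at h0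
  have h00 := (smul_eq_zero.1 h0.symm).resolve_right hjne
  refine ⟨j * kz + j * (j + 1), ?_⟩
  push_cast
  rw [← hkz]
  linear_combination h00

/-- Expand `v` in an eigenbasis of `B * A`. The eigenvalues are `‖A (b i)‖ ^ 2` and integral, so
each is either at least `1`, or zero, in which case `b i` lies in the kernel and `v` has no
component along it. -/
theorem norm_le_norm_apply_of_mem_ker_orthogonal {A B K : W →ₗ[ℂ] W}
    (hAB : ∀ x y, ⟪A x, y⟫_ℂ = ⟪x, B y⟫_ℂ)
    (hK : K = A * B - B * A) (hKA : K * A - A * K = (2 : ℂ) • A)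
    (hKint : ∀ μ, Module.End.HasEigenvalue K μ → ∃ n : ℤ, μ = n)
    {v : W} (hv : v ∈ (LinearMap.ker A)ᗮ) : ‖v‖ ≤ ‖A v‖ := by
  have hBA : ∀ x y, ⟪B x, y⟫_ℂ = ⟪x, A y⟫_ℂ := fun x y => by
    rw [← inner_conj_symm, ← hAB, inner_conj_symm]
  have hS : (B * A).IsSymmetric := fun x y => by
    simp only [Module.End.mul_apply, hBA, ← hAB]
  let b := hS.eigenvectorBasis rfl
  have hev : ∀ i, (B * A) (b i) = (hS.eigenvalues rfl i : ℂ) • b i :=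
    fun i => hS.apply_eigenvectorBasis rfl i
  have hval : ∀ i, (hS.eigenvalues rfl i) = ‖A (b i)‖ ^ 2 := by
    intro i
    have h1 : ⟪A (b i), A (b i)⟫_ℂ = (hS.eigenvalues rfl i : ℂ) := by
      rw [hAB, ← Module.End.mul_apply, hev, inner_smul_right, inner_self_eq_norm_sq_to_K,
        b.orthonormal.1 i]
      simp
    rw [inner_self_eq_norm_sq_to_K] at h1
    refine Complex.ofReal_injective ?_
    rw [Complex.ofReal_pow]
    exact h1.symm
  have hle : ∀ i, ‖⟪b i, v⟫_ℂ‖ ^ 2 ≤ hS.eigenvalues rfl i * ‖⟪b i, v⟫_ℂ‖ ^ 2 := by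
    intro i
    obtain ⟨n, hn⟩ := eigenvalue_adjoint_mul_self_integral hAB hK hKA hKint
      (hS.hasEigenvalue_eigenvalues rfl i)
    have hn' : hS.eigenvalues rfl i = (n : ℝ) :=
      Complex.ofReal_injective (by rw [Complex.ofReal_intCast]; exact hn)
    rcases eq_or_ne (hS.eigenvalues rfl i) 0 with h0 | h0
    · have hAb : A (b i) = 0 := by
        rw [hval i] at h0; simpa using h0
      have : ⟪b i, v⟫_ℂ = 0 := (Submodule.mem_orthogonal _ _).1 hv _ (LinearMap.mem_ker.2 hAb)
      simp [this]
    · have hpos : 0 < hS.eigenvalues rfl i :=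
        lt_of_le_of_ne (by rw [hval i]; positivity) h0.symm
      have : (1 : ℝ) ≤ hS.eigenvalues rfl i := by
        rw [hn'] at hpos ⊢
        exact_mod_cast hpos
      exact le_mul_of_one_le_left (by positivity) this
  have hsum : ‖A v‖ ^ 2 = ∑ i, hS.eigenvalues rfl i * ‖⟪b i, v⟫_ℂ‖ ^ 2 := by
    have h1 : ⟪v, (B * A) v⟫_ℂ = ∑ i, (hS.eigenvalues rfl i * ‖⟪b i, v⟫_ℂ‖ ^ 2 : ℂ) := by
      rw [← b.sum_inner_mul_inner v ((B * A) v)]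
      refine Finset.sum_congr rfl fun i _ => ?_
      rw [← hS (b i) v, hev, inner_smul_left, Complex.conj_ofReal, ← inner_conj_symm v (b i),
        mul_left_comm, Complex.conj_mul']
    have h2 : ⟪v, (B * A) v⟫_ℂ = ((‖A v‖ ^ 2 : ℝ) : ℂ) := by
      rw [Module.End.mul_apply, ← hAB, inner_self_eq_norm_sq_to_K]; simp
    rw [h2] at h1
    exact_mod_cast h1
  have hsq : ‖v‖ ^ 2 ≤ ‖A v‖ ^ 2 := by
    rw [hsum, ← b.sum_sq_norm_inner_right v]
    exact Finset.sum_le_sum fun i _ => hle i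
  exact (sq_le_sq₀ (norm_nonneg _) (norm_nonneg _)).1 hsq

/-- Solvability of the homological equation with a bound by `1`. -/
theorem exists_homological_solution {A B K : W →ₗ[ℂ] W}
    (hAB : ∀ x y, ⟪A x, y⟫_ℂ = ⟪x, B y⟫_ℂ)
    (hK : K = A * B - B * A) (hKA : K * A - A * K = (2 : ℂ) • A)
    (hKint : ∀ μ, Module.End.HasEigenvalue K μ → ∃ n : ℤ, μ = n) (g : W) :
    ∃ x r : W, A x + r = g ∧ B r = 0 ∧ ‖x‖ ≤ ‖g‖ ∧ ‖r‖ ≤ ‖g‖ := by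
  -- Here `r` is the part of `g` orthogonal to the range of `A`, that is, in the kernel of the
  -- adjoint; the preimage `x` is then taken orthogonal to the kernel of `A`.
  obtain ⟨y, hy, r, hr, hyr⟩ := (LinearMap.range A).exists_add_mem_mem_orthogonal g
  obtain ⟨x₀, rfl⟩ := hy
  obtain ⟨z, hz, x, hx, hzx⟩ := (LinearMap.ker A).exists_add_mem_mem_orthogonal x₀
  have hAx : A x₀ = A x := by
    rw [hzx, map_add, LinearMap.mem_ker.1 hz, zero_add]
  rw [hAx] at hyr
  have hperp : ⟪A x, r⟫_ℂ = 0 := (Submodule.mem_orthogonal _ _).1 hr _ ⟨x, rfl⟩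
  have hpyth : ‖g‖ * ‖g‖ = ‖A x‖ * ‖A x‖ + ‖r‖ * ‖r‖ := by
    rw [hyr]; exact norm_add_sq_eq_norm_sq_add_norm_sq_of_inner_eq_zero _ _ hperp
  refine ⟨x, r, hyr.symm, ?_, ?_, ?_⟩
  · refine ext_inner_left ℂ fun w => ?_
    rw [← hAB, inner_zero_right]
    exact (Submodule.mem_orthogonal _ _).1 hr _ ⟨w, rfl⟩
  · refine (norm_le_norm_apply_of_mem_ker_orthogonal hAB hK hKA hKint hx).trans ?_
    exact abs_le_of_sq_le_sq' (by nlinarith [norm_nonneg r]) (norm_nonneg _) |>.2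
  · exact abs_le_of_sq_le_sq' (by nlinarith [norm_nonneg (A x)]) (norm_nonneg _) |>.2

end Gap

/-! ### The matrix of a standard nilpotent operator -/

open scoped Matrix

/-- The square roots are the normalization for which the adjoint is the opposite element of the
`sl₂`-triple: the diagonal entry is `(i + 1) (k - i) - i (k - i + 1) = k - 2 i`. -/
theorem nilBlock_commutator (k : ℕ) :
    nilBlock k * (nilBlock k)ᴴ - (nilBlock k)ᴴ * nilBlock k =
      Matrix.diagonal fun i : Fin (k + 1) => (k : ℂ) - 2 * (i : ℕ) := by
  have key : ∀ i l : Fin (k + 1), nilBlock k i l * star (nilBlock k i l) =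
      if (l : ℕ) = (i : ℕ) + 1 then (((i : ℕ) + 1) * ((k : ℂ) - (i : ℕ))) else 0 := by
    intro i l
    simp only [nilBlock, Matrix.of_apply]
    split_ifs with h
    · have hi : (i : ℕ) ≤ k := by omega
      have h0 : (0 : ℝ) ≤ ((i : ℕ) + 1) * ((k : ℝ) - (i : ℕ)) := by
        have : ((i : ℕ) : ℝ) ≤ k := by exact_mod_cast hi
        exact mul_nonneg (by positivity) (by linarith)
      rw [Complex.star_def, Complex.conj_ofReal, ← Complex.ofReal_mul, Real.mul_self_sqrt h0]
      push_cast; ring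
    · simp
  have hz : ∀ i l : Fin (k + 1), (l : ℕ) ≠ (i : ℕ) + 1 → nilBlock k i l = 0 := by
    intro i l h; simp [nilBlock, h]
  ext i j
  rw [Matrix.sub_apply, Matrix.mul_apply, Matrix.mul_apply]
  simp only [Matrix.conjTranspose_apply]
  by_cases hij : i = j
  · subst hij
    rw [Matrix.diagonal_apply_eq]
    have s1 : ∑ l, nilBlock k i l * star (nilBlock k i l) = ((i : ℕ) + 1) * ((k : ℂ) - (i : ℕ)) := by
      simp only [key]
      by_cases hik : (i : ℕ) = k
      · rw [hik, sub_self, mul_zero]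
        refine Finset.sum_eq_zero fun l _ => ?_
        split_ifs <;> simp
      · have : (i : ℕ) + 1 < k + 1 := by omega
        rw [Finset.sum_eq_single (⟨i + 1, this⟩ : Fin (k + 1))]
        · simp
        · intro b _ hb
          rw [if_neg]
          intro h; exact hb (Fin.ext h)
        · simp
    have s2 : ∑ l, star (nilBlock k l i) * nilBlock k l i = (i : ℕ) * ((k : ℂ) - (i : ℕ) + 1) := by
      simp only [mul_comm (star _), key]
      by_cases hi0 : (i : ℕ) = 0
      · rw [hi0]
        simp
      · have : (i : ℕ) - 1 < k + 1 := by omega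
        rw [Finset.sum_eq_single (⟨i - 1, this⟩ : Fin (k + 1))]
        · have h1 : (i : ℕ) = (i : ℕ) - 1 + 1 := by omega
          rw [if_pos h1]
          have : (((i : ℕ) - 1 : ℕ) : ℂ) = (i : ℕ) - 1 := by
            rw [Nat.cast_sub (by omega)]; simp
          simp only [this]; ring
        · intro b _ hb
          rw [if_neg]
          intro h; exact hb (Fin.ext (by simp; omega))
        · simp
    rw [s1, s2]; ring
  · rw [Matrix.diagonal_apply_ne _ hij]
    rw [Finset.sum_eq_zero, Finset.sum_eq_zero, sub_zero]
    · intro l _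
      by_cases h1 : (i : ℕ) = (l : ℕ) + 1
      · have h2 : (j : ℕ) ≠ (l : ℕ) + 1 := fun h => hij (Fin.ext (by omega))
        rw [hz l j h2, mul_zero]
      · rw [hz l i h1]; simp
    · intro l _
      by_cases h1 : (l : ℕ) = (i : ℕ) + 1
      · have h2 : (l : ℕ) ≠ (j : ℕ) + 1 := fun h => hij (Fin.ext (by omega))
        rw [hz j l h2]; simp
      · rw [hz i l h1, zero_mul]

theorem nilBlock_weight (k : ℕ) :
    (Matrix.diagonal fun i : Fin (k + 1) => (k : ℂ) - 2 * (i : ℕ)) * nilBlock k -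
      nilBlock k * (Matrix.diagonal fun i : Fin (k + 1) => (k : ℂ) - 2 * (i : ℕ)) =
        (2 : ℂ) • nilBlock k := by
  ext i j
  rw [Matrix.sub_apply, Matrix.diagonal_mul, Matrix.mul_diagonal, Matrix.smul_apply, smul_eq_mul]
  by_cases h : (j : ℕ) = (i : ℕ) + 1
  · rw [h]; push_cast; ring
  · simp [nilBlock, h]

/-- The matrix of a standard nilpotent operator generates, with its adjoint, an `sl₂`-triple
whose neutral element is an integral diagonal matrix. -/
theorem IsStandardNilpotent.exists_matrix {m : ℕ} {N : Cspace m →L[ℂ] Cspace m}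
    (hN : IsStandardNilpotent N) :
    ∃ (M : Matrix (Fin m) (Fin m) ℂ) (d : Fin m → ℤ),
      N = Matrix.toEuclideanCLM (n := Fin m) (𝕜 := ℂ) M ∧
      M * Mᴴ - Mᴴ * M = Matrix.diagonal (fun i => (d i : ℂ)) ∧
      Matrix.diagonal (fun i => (d i : ℂ)) * M - M * Matrix.diagonal (fun i => (d i : ℂ)) =
        (2 : ℂ) • M := by
  obtain ⟨n, k, e, rfl⟩ := hN
  set B := Matrix.blockDiagonal' fun i => nilBlock (k i) with hB
  let D : (Σ i : Fin n, Fin (k i + 1)) → ℤ := fun s => (k s.1 : ℤ) - 2 * (s.2 : ℕ)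
  have hD : Matrix.diagonal (fun s => (D s : ℂ)) = Matrix.blockDiagonal' fun i =>
      Matrix.diagonal fun j : Fin (k i + 1) => (k i : ℂ) - 2 * (j : ℕ) := by
    rw [Matrix.blockDiagonal'_diagonal]
    congr 1; ext s; simp [D]
  have h1 : B * Bᴴ - Bᴴ * B = Matrix.diagonal (fun s => (D s : ℂ)) := by
    rw [hD, hB, Matrix.blockDiagonal'_conjTranspose, ← Matrix.blockDiagonal'_mul,
      ← Matrix.blockDiagonal'_mul, ← Matrix.blockDiagonal'_sub]
    congr 1; ext1 i; exact nilBlock_commutator (k i)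
  have h2 : Matrix.diagonal (fun s => (D s : ℂ)) * B - B * Matrix.diagonal (fun s => (D s : ℂ)) =
      (2 : ℂ) • B := by
    rw [hD, hB, ← Matrix.blockDiagonal'_mul, ← Matrix.blockDiagonal'_mul,
      ← Matrix.blockDiagonal'_sub, ← Matrix.blockDiagonal'_smul]
    congr 1; ext1 i; exact nilBlock_weight (k i)
  have hdd : Matrix.diagonal (fun i => ((D (e.symm i) : ℤ) : ℂ)) =
      (Matrix.diagonal (fun s => (D s : ℂ))).submatrix e.symm e.symm := by
    rw [Matrix.submatrix_diagonal_equiv]; rfl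
  refine ⟨_, fun i => D (e.symm i), rfl, ?_, ?_⟩
  · rw [hdd, ← h1, Matrix.reindex_apply, Matrix.conjTranspose_submatrix,
      Matrix.submatrix_mul_equiv, Matrix.submatrix_mul_equiv]
    rfl
  · rw [hdd, Matrix.reindex_apply, Matrix.submatrix_mul_equiv, Matrix.submatrix_mul_equiv]
    have := congrArg (fun Z => Z.submatrix e.symm e.symm) h2
    exact this

/-! ### Operators acting on one slot of a tensor -/

section Slot

variable {m : ℕ} {κ : Type*} [DecidableEq κ]

open scoped Matrix InnerProductSpace

/-- Exchanging the entry `J j` with `a` is an involution on pairs `(J, a)`. -/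
theorem sum_sum_update_swap [Fintype κ] {E α : Type*} [AddCommMonoid E] [Fintype α] (j : κ)
    (F : (κ → α) → α → E) :
    ∑ J, ∑ a, F J a = ∑ J, ∑ a, F (Function.update J j a) (J j) := by
  classical
  rw [← Fintype.sum_prod_type', ← Fintype.sum_prod_type']
  refine Fintype.sum_equiv ⟨fun p => (Function.update p.1 j p.2, p.1 j),
    fun p => (Function.update p.1 j p.2, p.1 j), fun p => by simp, fun p => by simp⟩ _ _ ?_
  intro p
  simp

/-- The operator `1 ⊗ ⋯ ⊗ B ⊗ ⋯ ⊗ 1` with `B` acting on the slot `j`. -/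
def slotOp (j : κ) (B : Matrix (Fin m) (Fin m) ℂ) :
    EuclideanSpace ℂ (κ → Fin m) →ₗ[ℂ] EuclideanSpace ℂ (κ → Fin m) where
  toFun w := WithLp.toLp 2 fun J => ∑ a, B (J j) a * w (Function.update J j a)
  map_add' x y := by
    ext J
    simp [mul_add, Finset.sum_add_distrib]
  map_smul' c x := by
    ext J
    simp [Finset.mul_sum, mul_left_comm]

theorem slotOp_apply (j : κ) (B : Matrix (Fin m) (Fin m) ℂ) (w : EuclideanSpace ℂ (κ → Fin m))
    (J : κ → Fin m) : slotOp j B w J = ∑ a, B (J j) a * w (Function.update J j a) := rfl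

theorem slotOp_mul (j : κ) (B B' : Matrix (Fin m) (Fin m) ℂ) :
    slotOp j B * slotOp j B' = slotOp j (B * B') := by
  ext w J
  simp only [Module.End.mul_apply, slotOp_apply, Matrix.mul_apply, Function.update_self,
    Function.update_idem, Finset.mul_sum, Finset.sum_mul]
  rw [Finset.sum_comm]
  simp only [mul_assoc]

theorem slotOp_commute {i j : κ} (hij : i ≠ j) (B B' : Matrix (Fin m) (Fin m) ℂ) :
    slotOp i B * slotOp j B' = slotOp j B' * slotOp i B := by
  ext w J
  simp only [Module.End.mul_apply, slotOp_apply, Finset.mul_sum,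
    Function.update_of_ne hij, Function.update_of_ne hij.symm]
  rw [Finset.sum_comm]
  refine Finset.sum_congr rfl fun a _ => Finset.sum_congr rfl fun b _ => ?_
  rw [Function.update_comm hij]
  ring

theorem slotOp_sub (j : κ) (B B' : Matrix (Fin m) (Fin m) ℂ) :
    slotOp j (B - B') = slotOp j B - slotOp j B' := by
  ext w J
  simp [slotOp_apply, sub_mul, Finset.sum_sub_distrib]

theorem slotOp_smul (j : κ) (c : ℂ) (B : Matrix (Fin m) (Fin m) ℂ) :
    slotOp j (c • B) = c • slotOp j B := by
  ext w J
  simp [slotOp_apply, Finset.mul_sum, mul_assoc]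

theorem slotOp_diagonal (j : κ) (d : Fin m → ℂ) (w : EuclideanSpace ℂ (κ → Fin m))
    (J : κ → Fin m) : slotOp j (Matrix.diagonal d) w J = d (J j) * w J := by
  rw [slotOp_apply, Finset.sum_eq_single (J j)]
  · simp
  · intro b _ hb
    rw [Matrix.diagonal_apply_ne _ hb.symm, zero_mul]
  · simp

variable [Fintype κ]

theorem slotOp_inner (j : κ) (B : Matrix (Fin m) (Fin m) ℂ)
    (x y : EuclideanSpace ℂ (κ → Fin m)) :
    ⟪slotOp j B x, y⟫_ℂ = ⟪x, slotOp j Bᴴ y⟫_ℂ := by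
  simp only [PiLp.inner_apply, RCLike.inner_apply, slotOp_apply, map_sum, map_mul,
    Finset.mul_sum, Finset.sum_mul, Matrix.conjTranspose_apply]
  rw [sum_sum_update_swap j]
  refine Finset.sum_congr rfl fun J _ => Finset.sum_congr rfl fun a _ => ?_
  simp only [Function.update_self, Function.update_idem, Function.update_eq_self,
    RCLike.star_def]
  ring

/-- The derivation of the tensor space acting by `B j` on the slot `j`. -/
def tensorOp (B : κ → Matrix (Fin m) (Fin m) ℂ) :
    EuclideanSpace ℂ (κ → Fin m) →ₗ[ℂ] EuclideanSpace ℂ (κ → Fin m) :=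
  ∑ j, slotOp j (B j)

/-- Operators on different slots commute, so only the diagonal terms survive. -/
theorem tensorOp_commutator (B B' : κ → Matrix (Fin m) (Fin m) ℂ) :
    tensorOp B * tensorOp B' - tensorOp B' * tensorOp B =
      tensorOp fun j => B j * B' j - B' j * B j := by
  simp only [tensorOp, Finset.sum_mul, Finset.mul_sum]
  rw [Finset.sum_comm, ← Finset.sum_sub_distrib]
  refine Finset.sum_congr rfl fun j _ => ?_
  rw [← Finset.sum_sub_distrib, Finset.sum_eq_single j]
  · rw [slotOp_mul, slotOp_mul, ← slotOp_sub]
  · intro i _ hij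
    rw [slotOp_commute hij, sub_self]
  · simp

theorem tensorOp_inner (B : κ → Matrix (Fin m) (Fin m) ℂ)
    (x y : EuclideanSpace ℂ (κ → Fin m)) :
    ⟪tensorOp B x, y⟫_ℂ = ⟪x, tensorOp (fun j => (B j)ᴴ) y⟫_ℂ := by
  simp [tensorOp, LinearMap.sum_apply, slotOp_inner]

/-- Solvability, with a bound by `1`, of the homological equation for tensors each of whose slots
carries a matrix `B j` forming with its adjoint an `sl₂`-triple with integral neutral element. -/
theorem exists_tensorOp_solution (B : κ → Matrix (Fin m) (Fin m) ℂ) (d : κ → Fin m → ℤ)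
    (h1 : ∀ j, B j * (B j)ᴴ - (B j)ᴴ * B j = Matrix.diagonal fun i => (d j i : ℂ))
    (h2 : ∀ j, Matrix.diagonal (fun i => (d j i : ℂ)) * B j -
      B j * Matrix.diagonal (fun i => (d j i : ℂ)) = (2 : ℂ) • B j)
    (g : EuclideanSpace ℂ (κ → Fin m)) :
    ∃ x r, tensorOp B x + r = g ∧ tensorOp (fun j => (B j)ᴴ) r = 0 ∧ ‖x‖ ≤ ‖g‖ ∧ ‖r‖ ≤ ‖g‖ := by
  refine exists_homological_solution
    (K := tensorOp fun j => Matrix.diagonal fun i => (d j i : ℂ)) (tensorOp_inner B) ?_ ?_ ?_ g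
  · rw [tensorOp_commutator]; simp only [h1]
  · rw [tensorOp_commutator]
    simp only [h2, tensorOp, slotOp_smul, Finset.smul_sum]
  -- The neutral element is diagonal in the standard basis of tensors, with entries that are sums of
  -- integers.
  · intro μ hμ
    obtain ⟨v, hv⟩ := hμ.exists_hasEigenvector
    obtain ⟨J, hJ⟩ : ∃ J, v J ≠ 0 := by
      by_contra h
      push Not at h
      exact hv.2 (by ext J; simpa using h J)
    have h := congrArg (fun w : EuclideanSpace ℂ (κ → Fin m) => w J) hv.apply_eq_smul
    simp only [tensorOp, LinearMap.sum_apply, PiLp.smul_apply, smul_eq_mul, WithLp.ofLp_sum,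
      Finset.sum_apply, slotOp_diagonal, ← Finset.sum_mul] at h
    refine ⟨∑ j, d j (J j), ?_⟩
    push_cast
    exact (mul_right_cancel₀ hJ h).symm

end Slot

/-! ### Homogeneous polynomial maps given by tensors -/

section Tensor

variable {m : ℕ} {ι : Type*} [Fintype ι] [DecidableEq ι]

/-- Tensors with slots indexed by `ι` and values in `ℂ^m`, with the Hilbert–Schmidt norm. -/
abbrev Tensor (m : ℕ) (ι : Type*) [Fintype ι] [DecidableEq ι] : Type _ :=
  PiLp 2 fun _ : ι → Fin m => Cspace m

/-- The multilinear map with given coefficients on the standard basis. -/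
def Tensor.toML (c : Tensor m ι) :
    ContinuousMultilinearMap ℂ (fun _ : ι => Cspace m) (Cspace m) :=
  ∑ I : ι → Fin m, ((ContinuousMultilinearMap.mkPiAlgebra ℂ ι ℂ).compContinuousLinearMap
    fun j => (EuclideanSpace.proj (I j) : Cspace m →L[ℂ] ℂ)).smulRight (c I)

theorem Tensor.toML_apply (c : Tensor m ι) (x : ι → Cspace m) :
    c.toML x = ∑ I : ι → Fin m, (∏ j, x j (I j)) • c I := by
  simp [Tensor.toML]

theorem sum_prod_norm_sq (x : ι → Cspace m) :
    ∑ I : ι → Fin m, ∏ j, ‖x j (I j)‖ ^ 2 = ∏ j, ‖x j‖ ^ 2 := by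
  simp_rw [EuclideanSpace.norm_sq_eq]
  rw [Finset.prod_univ_sum, Fintype.piFinset_univ]

theorem Tensor.norm_toML_le (c : Tensor m ι) (x : ι → Cspace m) :
    ‖c.toML x‖ ≤ ‖c‖ * ∏ j, ‖x j‖ := by
  rw [Tensor.toML_apply]
  refine (norm_sum_le _ _).trans ?_
  simp only [norm_smul, norm_prod]
  have h := Finset.sum_mul_sq_le_sq_mul_sq Finset.univ (fun I : ι → Fin m => ∏ j, ‖x j (I j)‖)
    (fun I => ‖c I‖)
  simp only [← Finset.prod_pow, sum_prod_norm_sq, ← PiLp.norm_sq_eq_of_L2] at h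
  rw [Finset.prod_pow, ← mul_pow] at h
  rw [mul_comm]
  exact (abs_le_of_sq_le_sq' h (by positivity)).2

end Tensor

variable {m : ℕ}

/-- `P` is the homogeneous polynomial map of degree `k` of a tensor of norm at most `B`. -/
def HSPoly (k : ℕ) (P : Cspace m → Cspace m) (B : ℝ) : Prop :=
  ∃ c : Tensor m (Fin k), ‖c‖ ≤ B ∧ ∀ y, P y = c.toML fun _ => y

namespace HSPoly

/-- Substitution and differentiation naturally produce tensors indexed by sigma or sum types; this
relabels their slots. No symmetry of the tensor is ever required. -/
theorem of_tensor {ι : Type*} [Fintype ι] [DecidableEq ι] {k : ℕ} (hk : Fintype.card ι = k)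
    {P : Cspace m → Cspace m} {B : ℝ} (hB0 : 0 ≤ B) (c : Tensor m ι)
    (hB : ∑ I, ‖c I‖ ^ 2 ≤ B ^ 2) (hP : ∀ y, P y = c.toML fun _ => y) : HSPoly k P B := by
  let e : ι ≃ Fin k := Fintype.equivFinOfCardEq hk
  let E : (ι → Fin m) ≃ (Fin k → Fin m) := e.arrowCongr (Equiv.refl _)
  refine ⟨WithLp.toLp 2 fun I => c (E.symm I), ?_, fun y => ?_⟩
  · refine (sq_le_sq₀ (norm_nonneg _) hB0).1 (le_trans (le_of_eq ?_) hB)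
    rw [PiLp.norm_sq_eq_of_L2]
    exact Fintype.sum_equiv E.symm _ _ fun I => rfl
  · rw [hP, Tensor.toML_apply, Tensor.toML_apply]
    refine Fintype.sum_equiv E _ _ fun I => ?_
    simp only [Equiv.symm_apply_apply]
    congr 1
    exact Fintype.prod_equiv e _ _ fun j => by simp [E]

variable {k l : ℕ} {P R : Cspace m → Cspace m} {B B' : ℝ}

theorem nonneg (h : HSPoly k P B) : 0 ≤ B := by
  obtain ⟨c, hc, -⟩ := h
  exact (norm_nonneg _).trans hc

theorem mono (h : HSPoly k P B) (hB : B ≤ B') : HSPoly k P B' := by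
  obtain ⟨c, hc, hP⟩ := h
  exact ⟨c, hc.trans hB, hP⟩

theorem zero (k : ℕ) : HSPoly k (fun _ : Cspace m => (0 : Cspace m)) 0 :=
  ⟨0, by simp, fun y => by simp [Tensor.toML_apply]⟩

theorem add (h : HSPoly k P B) (h' : HSPoly k R B') : HSPoly k (fun y => P y + R y) (B + B') := by
  obtain ⟨c, hc, hP⟩ := h
  obtain ⟨d, hd, hR⟩ := h'
  refine ⟨c + d, (norm_add_le _ _).trans (add_le_add hc hd), fun y => ?_⟩
  simp only [hP, hR, Tensor.toML_apply, PiLp.add_apply, smul_add, Finset.sum_add_distrib]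

theorem neg (h : HSPoly k P B) : HSPoly k (fun y => -P y) B := by
  obtain ⟨c, hc, hP⟩ := h
  refine ⟨-c, by rwa [norm_neg], fun y => ?_⟩
  simp only [hP, Tensor.toML_apply, PiLp.neg_apply, smul_neg, Finset.sum_neg_distrib]

theorem sum {α : Type*} (s : Finset α) {P : α → Cspace m → Cspace m} {B : α → ℝ}
    (h : ∀ i ∈ s, HSPoly k (P i) (B i)) :
    HSPoly k (fun y => ∑ i ∈ s, P i y) (∑ i ∈ s, B i) := by
  classical
  induction s using Finset.induction_on with
  | empty => simpa using zero k
  | insert a s ha ih =>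
    simp only [Finset.sum_insert ha]
    exact (h a (Finset.mem_insert_self a s)).add
      (ih fun i hi => h i (Finset.mem_insert_of_mem hi))

/-- The Hilbert–Schmidt norm of the identity is the source of the factor `√m` in the estimates. -/
theorem id : HSPoly 1 (fun y : Cspace m => y) (Real.sqrt m) := by
  refine ⟨WithLp.toLp 2 fun I => EuclideanSpace.single (I 0) 1, ?_, fun y => ?_⟩
  · rw [PiLp.norm_eq_of_L2]
    simp
  · rw [Tensor.toML_apply, ← (Equiv.funUnique (Fin 1) (Fin m)).symm.sum_comp]
    ext i
    simp [Pi.single_apply]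

theorem norm_le (h : HSPoly k P B) (y : Cspace m) : ‖P y‖ ≤ B * ‖y‖ ^ k := by
  obtain ⟨c, hc, hP⟩ := h
  rw [hP]
  refine (c.norm_toML_le _).trans ?_
  simp only [Finset.prod_const, Finset.card_univ, Fintype.card_fin]
  gcongr

theorem _root_.NilpotentNF.Tensor.hasFDerivAt_diag {k : ℕ} (c : Tensor m (Fin k)) (y : Cspace m) :
    HasFDerivAt (fun y => c.toML fun _ => y)
      (∑ j, (c.toML).toContinuousLinearMap (fun _ => y) j) y := by
  simpa using (HasFDerivAt.multilinear_comp (f := c.toML) (g := fun (_ : Fin k) (y : Cspace m) => y)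
    (g' := fun _ => ContinuousLinearMap.id ℂ _) (x := y) fun _ => hasFDerivAt_id y)

theorem fderiv_eq {c : Tensor m (Fin k)} (hP : ∀ y, P y = c.toML fun _ => y) (y v : Cspace m) :
    fderiv ℂ P y v = ∑ j, c.toML (Function.update (fun _ => y) j v) := by
  rw [show P = fun y => c.toML fun _ => y from funext hP, (c.hasFDerivAt_diag y).fderiv]
  simp

theorem analyticAt (h : HSPoly k P B) (y : Cspace m) : AnalyticAt ℂ P y := by
  obtain ⟨c, hc, hP⟩ := h
  rw [show P = fun y => ∑ I : Fin k → Fin m, (∏ j, y (I j)) • c I from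
    funext fun y => by rw [hP, Tensor.toML_apply]]
  refine Finset.analyticAt_fun_sum _ fun I _ => AnalyticAt.fun_smul ?_ analyticAt_const
  refine Finset.analyticAt_fun_prod _ fun j _ => ?_
  exact (EuclideanSpace.proj (I j) : Cspace m →L[ℂ] ℂ).analyticAt y

theorem differentiable (h : HSPoly k P B) : Differentiable ℂ P :=
  fun y => (h.analyticAt y).differentiableAt

theorem norm_fderiv_apply_le (h : HSPoly k P B) (y v : Cspace m) :
    ‖fderiv ℂ P y v‖ ≤ k * B * ‖y‖ ^ (k - 1) * ‖v‖ := by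
  have hB := h.nonneg
  obtain ⟨c, hc, hP⟩ := h
  rw [fderiv_eq hP]
  refine (norm_sum_le _ _).trans ?_
  have : ∀ j ∈ (Finset.univ : Finset (Fin k)), ‖c.toML (Function.update (fun _ => y) j v)‖ ≤
      B * ‖y‖ ^ (k - 1) * ‖v‖ := by
    intro j _
    refine (c.norm_toML_le _).trans ?_
    have h1 : ∏ i, ‖Function.update (fun _ => y) j v i‖ = ‖y‖ ^ (k - 1) * ‖v‖ := by
      rw [Fintype.prod_eq_mul_prod_compl j, Function.update_self, mul_comm]
      congr 1
      rw [Finset.prod_congr rfl (g := fun _ => ‖y‖)]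
      · simp [Finset.card_compl]
      · intro i hi
        rw [Function.update_of_ne (by simpa using hi)]
    rw [h1, mul_assoc]
    gcongr
  refine (Finset.sum_le_card_nsmul _ _ _ this).trans (le_of_eq ?_)
  simp; ring

/-- Substitution of homogeneous polynomial maps into a bounded multilinear map. -/
theorem multilinear_comp {δ : ℕ}
    (f : ContinuousMultilinearMap ℂ (fun _ : Fin δ => Cspace m) (Cspace m)) {A : ℝ} (hA : 0 ≤ A)
    (hf : ∀ x, ‖f x‖ ≤ A * ∏ i, ‖x i‖) {κ : Fin δ → ℕ} {P : Fin δ → Cspace m → Cspace m}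
    {B : Fin δ → ℝ} (h : ∀ i, HSPoly (κ i) (P i) (B i)) :
    HSPoly (∑ i, κ i) (fun y => f fun i => P i y) (A * ∏ i, B i) := by
  have hB : ∀ i, 0 ≤ B i := fun i => (h i).nonneg
  choose c hc hP using h
  let E : ((s : Σ i, Fin (κ i)) → Fin m) ≃ ((i : Fin δ) → Fin (κ i) → Fin m) :=
    Equiv.piCurry fun _ _ => Fin m
  refine of_tensor (ι := Σ i, Fin (κ i)) (by simp)
    (mul_nonneg hA (Finset.prod_nonneg fun i _ => hB i))
    (WithLp.toLp 2 fun I => f fun i => c i (E I i)) ?_ fun y => ?_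
  -- Applying the multilinear bound of `f` to each family of coefficient vectors avoids the
  -- Hilbert–Schmidt norm of `f`, and with it a power of `m` growing with `δ`.
  · calc ∑ I, ‖f fun i => c i (E I i)‖ ^ 2
        ≤ ∑ I, A ^ 2 * ∏ i, ‖c i (E I i)‖ ^ 2 := by
          refine Finset.sum_le_sum fun I _ => ?_
          rw [Finset.prod_pow, ← mul_pow]
          exact pow_le_pow_left₀ (norm_nonneg _) (hf _) 2
      _ = A ^ 2 * ∏ i, ‖c i‖ ^ 2 := by
          rw [← Finset.mul_sum, E.sum_comp fun J => ∏ i, ‖c i (J i)‖ ^ 2]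
          simp_rw [PiLp.norm_sq_eq_of_L2]
          rw [Finset.prod_univ_sum, Fintype.piFinset_univ]
      _ ≤ (A * ∏ i, B i) ^ 2 := by
          rw [mul_pow, ← Finset.prod_pow]
          gcongr with i
          exact hc i
  · simp only [hP, Tensor.toML_apply]
    rw [f.map_sum, ← E.sum_comp]
    refine Finset.sum_congr rfl fun I _ => ?_
    rw [f.map_smul_univ, Fintype.prod_sigma]
    rfl

/-- The derivative of a homogeneous polynomial map in the direction of another one. -/
theorem fderiv_apply (h : HSPoly k P B) (h' : HSPoly l R B') {n : ℕ} (hn : k + l = n + 1) :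
    HSPoly n (fun y => fderiv ℂ P y (R y)) (k * B * B') := by
  have hB := h.nonneg
  have hB' := h'.nonneg
  obtain ⟨c, hc, hP⟩ := h
  obtain ⟨r, hr, hR⟩ := h'
  have key : ∀ j ∈ (Finset.univ : Finset (Fin k)),
      HSPoly n (fun y => c.toML (Function.update (fun _ => y) j (R y))) (B * B') := by
    intro j _
    -- The slot `j` of `c` is contracted with the value of `r`, leaving `(k - 1) + l = n` slots;
    -- Cauchy–Schwarz over the contracted index bounds the result by the product of the norms.
    let S := Equiv.funSplitAt j (Fin m)
    let F : ({i // i ≠ j} ⊕ Fin l → Fin m) ≃ ({i // i ≠ j} → Fin m) × (Fin l → Fin m) :=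
      Equiv.sumArrowEquivProdArrow _ _ _
    have hcard : Fintype.card ({i // i ≠ j} ⊕ Fin l) = n := by
      have := j.2
      simp; omega
    refine of_tensor hcard (mul_nonneg hB hB')
      (WithLp.toLp 2 fun I => ∑ a, (r (F I).2 a) • c (S.symm (a, (F I).1))) ?_ fun y => ?_
    · have hle : ∀ p : ({i // i ≠ j} → Fin m) × (Fin l → Fin m),
          ‖∑ a, (r p.2 a) • c (S.symm (a, p.1))‖ ^ 2 ≤
            ‖r p.2‖ ^ 2 * ∑ a, ‖c (S.symm (a, p.1))‖ ^ 2 := by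
        intro p
        have h1 : ‖∑ a, (r p.2 a) • c (S.symm (a, p.1))‖ ≤
            ∑ a, ‖r p.2 a‖ * ‖c (S.symm (a, p.1))‖ :=
          (norm_sum_le _ _).trans (le_of_eq (by simp only [norm_smul]))
        refine (pow_le_pow_left₀ (norm_nonneg _) h1 2).trans ?_
        rw [EuclideanSpace.norm_sq_eq]
        exact Finset.sum_mul_sq_le_sq_mul_sq _ _ _
      calc ∑ I, ‖∑ a, (r (F I).2 a) • c (S.symm (a, (F I).1))‖ ^ 2
          = ∑ p : ({i // i ≠ j} → Fin m) × (Fin l → Fin m),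
              ‖∑ a, (r p.2 a) • c (S.symm (a, p.1))‖ ^ 2 :=
            F.sum_comp fun p => ‖∑ a, (r p.2 a) • c (S.symm (a, p.1))‖ ^ 2
        _ ≤ ∑ p : ({i // i ≠ j} → Fin m) × (Fin l → Fin m),
              ‖r p.2‖ ^ 2 * ∑ a, ‖c (S.symm (a, p.1))‖ ^ 2 :=
            Finset.sum_le_sum fun p _ => hle p
        _ = ‖c‖ ^ 2 * ‖r‖ ^ 2 := by
            rw [PiLp.norm_sq_eq_of_L2, PiLp.norm_sq_eq_of_L2, ← S.symm.sum_comp,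
              Fintype.sum_prod_type, Fintype.sum_prod_type_right, Finset.sum_mul_sum]
            refine Finset.sum_congr rfl fun I _ => Finset.sum_congr rfl fun J _ => ?_
            rw [mul_comm]
        _ ≤ (B * B') ^ 2 := by
            rw [mul_pow]; gcongr
    · rw [Tensor.toML_apply, Tensor.toML_apply, ← S.symm.sum_comp, ← F.symm.sum_comp,
        Fintype.sum_prod_type_right, Fintype.sum_prod_type]
      refine Finset.sum_congr rfl fun I _ => ?_
      simp only [Equiv.apply_symm_apply, Finset.smul_sum]
      rw [Finset.sum_comm]
      refine Finset.sum_congr rfl fun a _ => ?_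
      have hprod : ∏ i, (Function.update (fun _ => y) j (R y) i) (S.symm (a, I) i) =
          R y a * ∏ i : {i // i ≠ j}, y (I i) := by
        rw [Fintype.prod_eq_mul_prod_subtype_ne _ j, Function.update_self]
        congr 1
        · simp [S]
        · refine Finset.prod_congr rfl fun i _ => ?_
          rw [Function.update_of_ne i.2]
          simp [S, i.2]
      have hRa : R y a = ∑ J, (∏ i, y (J i)) * r J a := by
        rw [hR, Tensor.toML_apply]
        simp
      rw [hprod, hRa, Finset.sum_mul, Finset.sum_smul]
      refine Finset.sum_congr rfl fun J _ => ?_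
      rw [smul_smul, Fintype.prod_sum_type]
      congr 1
      simp [F]
      ring
  have hs := HSPoly.sum Finset.univ key
  simp only [← fderiv_eq hP] at hs
  refine hs.mono (le_of_eq ?_)
  simp; ring

end HSPoly

/-! ### The homological operator as a sum of slot operators -/

section Homological

open scoped Matrix

variable {ι : Type*} [Fintype ι] [DecidableEq ι]

/-- Vector valued tensors as scalar tensors with the additional slot `none`. -/
def Tensor.ofScalar (w : EuclideanSpace ℂ (Option ι → Fin m)) : Tensor m ι :=
  WithLp.toLp 2 fun I => WithLp.toLp 2 fun i => w (Equiv.piOptionEquivProd.symm (i, I))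

theorem Tensor.norm_ofScalar (w : EuclideanSpace ℂ (Option ι → Fin m)) :
    ‖Tensor.ofScalar w‖ = ‖w‖ := by
  refine (sq_eq_sq₀ (norm_nonneg _) (norm_nonneg _)).1 ?_
  rw [PiLp.norm_sq_eq_of_L2, EuclideanSpace.norm_sq_eq,
    ← (Equiv.piOptionEquivProd (β := fun _ : Option ι => Fin m)).symm.sum_comp,
    Fintype.sum_prod_type_right]
  refine Finset.sum_congr rfl fun I _ => ?_
  rw [EuclideanSpace.norm_sq_eq]
  rfl

theorem Tensor.exists_ofScalar (c : Tensor m ι) : ∃ w, Tensor.ofScalar w = c := by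
  refine ⟨WithLp.toLp 2 fun J => c (Equiv.piOptionEquivProd J).2 (Equiv.piOptionEquivProd J).1, ?_⟩
  ext I i
  simp [Tensor.ofScalar]

/-- The action of a matrix on the slots of a tensor that corresponds to
`Φ ↦ DΦ(y) M y - M Φ(y)`. -/
def adSlots (ι : Type*) (M : Matrix (Fin m) (Fin m) ℂ) : Option ι → Matrix (Fin m) (Fin m) ℂ
  | none => -M
  | some _ => Mᵀ

theorem tensorOp_adSlots_apply (M : Matrix (Fin m) (Fin m) ℂ)
    (w : EuclideanSpace ℂ (Option ι → Fin m)) (J : Option ι → Fin m) :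
    tensorOp (adSlots ι M) w J =
      (∑ j : ι, ∑ a, M a (J (some j)) * w (Function.update J (some j) a)) +
        ∑ a, -M (J none) a * w (Function.update J none a) := by
  simp [tensorOp, slotOp_apply, adSlots, Fintype.sum_option, add_comm]

/-- Replacing one argument `y` by `M y` acts on the coefficients by the transpose of `M` in that
slot, while composing with `-M` acts on the output slot `none`. -/
theorem Tensor.toML_ofScalar_tensorOp (M : Matrix (Fin m) (Fin m) ℂ)
    (w : EuclideanSpace ℂ (Option ι → Fin m)) (y : Cspace m) :
    (Tensor.ofScalar (tensorOp (adSlots ι M) w)).toML (fun _ => y) =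
      ∑ j, (Tensor.ofScalar w).toML
        (Function.update (fun _ => y) j (Matrix.toEuclideanCLM (n := Fin m) (𝕜 := ℂ) M y)) -
      Matrix.toEuclideanCLM (n := Fin m) (𝕜 := ℂ) M ((Tensor.ofScalar w).toML fun _ => y) := by
  ext i
  have hsome : ∀ (j : ι) (I : ι → Fin m) (a : Fin m),
      Function.update ((Equiv.piOptionEquivProd (β := fun _ : Option ι => Fin m)).symm (i, I))
        (some j) a = Equiv.piOptionEquivProd.symm (i, Function.update I j a) := by
    intro j I a
    ext o
    cases o with
    | none => simp
    | some o =>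
      by_cases h : o = j
      · subst h; simp
      · rw [Function.update_of_ne (by simpa using h)]
        simp [h]
  have hnone : ∀ (I : ι → Fin m) (a : Fin m),
      Function.update ((Equiv.piOptionEquivProd (β := fun _ : Option ι => Fin m)).symm (i, I))
        none a = Equiv.piOptionEquivProd.symm (a, I) := by
    intro I a
    ext o
    cases o <;> simp
  have hslot : ∀ j : ι, ∑ I : ι → Fin m, (∏ l, y (I l)) *
      ∑ a, M a (I j) * w (Equiv.piOptionEquivProd.symm (i, Function.update I j a)) =
      ((Tensor.ofScalar w).toML
        (Function.update (fun _ => y) j (Matrix.toEuclideanCLM (n := Fin m) (𝕜 := ℂ) M y))) i := by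
    intro j
    rw [Tensor.toML_apply]
    simp only [Finset.mul_sum]
    rw [sum_sum_update_swap j]
    simp only [Function.update_self, Function.update_idem, Function.update_eq_self,
      WithLp.ofLp_sum, Finset.sum_apply, PiLp.smul_apply, smul_eq_mul]
    refine Finset.sum_congr rfl fun I _ => ?_
    rw [Fintype.prod_eq_mul_prod_compl j, Function.update_self, Matrix.ofLp_toEuclideanCLM,
      Matrix.mulVec, dotProduct, Finset.sum_mul, Finset.sum_mul]
    refine Finset.sum_congr rfl fun a _ => ?_
    rw [Fintype.prod_eq_mul_prod_compl j, Function.update_self]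
    have e1 : ∏ l ∈ ({j}ᶜ : Finset ι), y (Function.update I j a l) =
        ∏ l ∈ ({j}ᶜ : Finset ι), y (I l) :=
      Finset.prod_congr rfl fun l hl => by
        rw [Function.update_of_ne (by simpa using hl)]
    have e2 : ∏ l ∈ ({j}ᶜ : Finset ι), (Function.update (fun _ => y) j
        (Matrix.toEuclideanCLM (n := Fin m) (𝕜 := ℂ) M y) l : Cspace m) (I l) =
        ∏ l ∈ ({j}ᶜ : Finset ι), y (I l) :=
      Finset.prod_congr rfl fun l hl => by
        rw [Function.update_of_ne (by simpa using hl)]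
    rw [e1, e2]
    simp only [Tensor.ofScalar]
    ring
  rw [PiLp.sub_apply, WithLp.ofLp_sum, Finset.sum_apply]
  simp only [← hslot]
  rw [Matrix.ofLp_toEuclideanCLM, Matrix.mulVec, dotProduct, Tensor.toML_apply, Tensor.toML_apply]
  simp only [WithLp.ofLp_sum, Finset.sum_apply, PiLp.smul_apply, smul_eq_mul]
  simp only [Tensor.ofScalar, tensorOp_adSlots_apply, hsome, hnone, mul_add,
    Finset.sum_add_distrib, Equiv.piOptionEquivProd_symm_apply]
  rw [add_comm, sub_eq_add_neg, add_comm]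
  congr 1
  · simp only [Finset.mul_sum]
    rw [Finset.sum_comm]
  · simp only [Finset.mul_sum]
    rw [Finset.sum_comm, ← Finset.sum_neg_distrib]
    refine Finset.sum_congr rfl fun a _ => ?_
    rw [← Finset.sum_neg_distrib]
    refine Finset.sum_congr rfl fun I _ => ?_
    simp
    ring

/-- The slots carry `-M` or `Mᵀ`, both of which form `sl₂`-triples with their adjoints, so the
spectral gap applies. The adjoint of the operator is the same operator built from `Mᴴ`, which gives
the condition on `R`. -/
theorem IsStandardNilpotent.exists_homological {N : Cspace m →L[ℂ] Cspace m}
    (hN : IsStandardNilpotent N) {k : ℕ} {G : Cspace m → Cspace m} {B : ℝ} (hG : HSPoly k G B) :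
    ∃ Φ R : Cspace m → Cspace m, HSPoly k Φ B ∧ HSPoly k R B ∧
      (∀ y, fderiv ℂ Φ y (N y) - N (Φ y) + R y = G y) ∧
      ∀ y, fderiv ℂ R y (ContinuousLinearMap.adjoint N y) =
        ContinuousLinearMap.adjoint N (R y) := by
  obtain ⟨M, d, rfl, h1, h2⟩ := hN.exists_matrix
  obtain ⟨g, hg, hGg⟩ := hG
  obtain ⟨g, rfl⟩ := g.exists_ofScalar
  rw [Tensor.norm_ofScalar] at hg
  have hadj : ContinuousLinearMap.adjoint (Matrix.toEuclideanCLM (n := Fin m) (𝕜 := ℂ) M) =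
      Matrix.toEuclideanCLM (n := Fin m) (𝕜 := ℂ) Mᴴ := by
    rw [← ContinuousLinearMap.star_eq_adjoint, ← map_star, Matrix.star_eq_conjTranspose]
  have hslots : (fun o => (adSlots (Fin k) M o)ᴴ) = adSlots (Fin k) Mᴴ := by
    ext o : 1
    cases o with
    | none => simp [adSlots]
    | some j => ext a b; simp [adSlots]
  -- Transposition reverses commutators, so the weights change sign on the input slots.
  let D : Option (Fin k) → Fin m → ℤ := fun o i => match o with
    | none => d i
    | some _ => -d i
  have hc1 : ∀ o, adSlots (Fin k) M o * (adSlots (Fin k) M o)ᴴ -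
      (adSlots (Fin k) M o)ᴴ * adSlots (Fin k) M o =
        Matrix.diagonal fun i => (D o i : ℂ) := by
    intro o
    cases o with
    | none =>
      simp only [adSlots, D, Matrix.conjTranspose_neg, neg_mul_neg]
      exact h1
    | some j =>
      have := congrArg Matrix.transpose h1
      simp only [Matrix.transpose_sub, Matrix.transpose_mul, Matrix.diagonal_transpose] at this
      simp only [adSlots, D]
      rw [show (fun i => ((-d i : ℤ) : ℂ)) = fun i => -(d i : ℂ) by ext; simp,
        ← Matrix.diagonal_neg, ← this, neg_sub]
      rfl
  have hc2 : ∀ o, Matrix.diagonal (fun i => (D o i : ℂ)) * adSlots (Fin k) M o -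
      adSlots (Fin k) M o * Matrix.diagonal (fun i => (D o i : ℂ)) =
        (2 : ℂ) • adSlots (Fin k) M o := by
    intro o
    cases o with
    | none =>
      simp only [adSlots, D, mul_neg, neg_mul, smul_neg]
      rw [← h2]
      abel
    | some j =>
      have := congrArg Matrix.transpose h2
      simp only [Matrix.transpose_sub, Matrix.transpose_mul, Matrix.diagonal_transpose,
        Matrix.transpose_smul] at this
      simp only [adSlots, D]
      rw [show (fun i => ((-d i : ℤ) : ℂ)) = fun i => -(d i : ℂ) by ext; simp,
        ← Matrix.diagonal_neg, ← this]
      simp only [neg_mul, mul_neg]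
      abel
  obtain ⟨x, r, hxr, hr, hx, hr'⟩ := exists_tensorOp_solution (adSlots (Fin k) M) D hc1 hc2 g
  rw [hslots] at hr
  refine ⟨fun y => (Tensor.ofScalar x).toML fun _ => y,
      fun y => (Tensor.ofScalar r).toML fun _ => y,
      ⟨_, (Tensor.norm_ofScalar x).trans_le (hx.trans hg), fun _ => rfl⟩,
      ⟨_, (Tensor.norm_ofScalar r).trans_le (hr'.trans hg), fun _ => rfl⟩, fun y => ?_, fun y => ?_⟩
  · rw [HSPoly.fderiv_eq (fun _ => rfl), ← Tensor.toML_ofScalar_tensorOp, hGg, ← hxr]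
    simp only [Tensor.toML_apply, ← Finset.sum_add_distrib, ← smul_add]
    refine Finset.sum_congr rfl fun I _ => ?_
    congr 1
  · rw [hadj, HSPoly.fderiv_eq (fun _ => rfl), ← sub_eq_zero, ← Tensor.toML_ofScalar_tensorOp, hr,
      Tensor.toML_apply]
    refine Finset.sum_eq_zero fun I _ => ?_
    have : (Tensor.ofScalar (0 : EuclideanSpace ℂ (Option (Fin k) → Fin m))) I = 0 := by
      ext i; simp [Tensor.ofScalar]
    rw [this, smul_zero]

end Homological

/-! ### Recursive construction of the terms and of their bounds -/

/-- Compositions of `k` into `δ` positive parts smaller than `k`. -/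
def comps (δ k : ℕ) : Finset (Fin δ → ℕ) :=
  {κ ∈ Fintype.piFinset fun _ => Finset.Icc 1 (k - 1) | ∑ i, κ i = k}

/-- The right-hand side of the homological equation of degree `k`. -/
def homSource (f : (δ : ℕ) → ContinuousMultilinearMap ℂ (fun _ : Fin δ => Cspace m) (Cspace m))
    (Φ R : ℕ → Cspace m → Cspace m) (k : ℕ) (y : Cspace m) : Cspace m :=
  ∑ δ ∈ Finset.Icc 2 k, ∑ κ ∈ comps δ k, f δ (fun i => Φ (κ i) y) -
    ∑ l ∈ Finset.Icc 2 (k - 1), fderiv ℂ (Φ l) y (R (k + 1 - l) y)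

/-- The bound on `homSource` obtained from bounds `φ` on the terms of lower degree. -/
def sourceBound (A φ : ℕ → ℝ) (k : ℕ) : ℝ :=
  ∑ δ ∈ Finset.Icc 2 k, ∑ κ ∈ comps δ k, A δ * ∏ i, φ (κ i) +
    ∑ l ∈ Finset.Icc 2 (k - 1), l * φ l * φ (k + 1 - l)

theorem mem_comps {δ k : ℕ} {κ : Fin δ → ℕ} :
    κ ∈ comps δ k ↔ (∀ i, κ i ∈ Finset.Icc 1 (k - 1)) ∧ ∑ i, κ i = k := by
  simp only [comps, Finset.mem_filter, Fintype.mem_piFinset]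

/-- Only degrees below `k` enter, so the recursion may define the term of degree `p + 1` by updating
the families without disturbing the earlier equations. -/
theorem homSource_congr
    (f : (δ : ℕ) → ContinuousMultilinearMap ℂ (fun _ : Fin δ => Cspace m) (Cspace m))
    {Φ Φ' R R' : ℕ → Cspace m → Cspace m} {k : ℕ} (hΦ : ∀ l < k, Φ l = Φ' l)
    (hR : ∀ l < k, R l = R' l) (y : Cspace m) :
    homSource f Φ R k y = homSource f Φ' R' k y := by
  unfold homSource
  congr 1
  · refine Finset.sum_congr rfl fun δ hδ => Finset.sum_congr rfl fun κ hκ => ?_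
    congr 1
    ext1 i
    have h1 := Finset.mem_Icc.1 ((mem_comps.1 hκ).1 i)
    rw [hΦ _ (by omega)]
  · refine Finset.sum_congr rfl fun l hl => ?_
    rw [Finset.mem_Icc] at hl
    rw [hΦ l (by omega), hR _ (by omega)]

theorem sourceBound_congr (A : ℕ → ℝ) {φ φ' : ℕ → ℝ} {k : ℕ} (hφ : ∀ l < k, φ l = φ' l) :
    sourceBound A φ k = sourceBound A φ' k := by
  unfold sourceBound
  congr 1
  · refine Finset.sum_congr rfl fun δ hδ => Finset.sum_congr rfl fun κ hκ => ?_
    congr 1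
    refine Finset.prod_congr rfl fun i _ => ?_
    have h1 := Finset.mem_Icc.1 ((mem_comps.1 hκ).1 i)
    rw [hφ _ (by omega)]
  · refine Finset.sum_congr rfl fun l hl => ?_
    rw [Finset.mem_Icc] at hl
    rw [hφ l (by omega), hφ _ (by omega)]

theorem HSPoly.homSource
    {f : (δ : ℕ) → ContinuousMultilinearMap ℂ (fun _ : Fin δ => Cspace m) (Cspace m)}
    {A : ℕ → ℝ} (hA : ∀ δ, 0 ≤ A δ) (hf : ∀ δ, 2 ≤ δ → ∀ x, ‖f δ x‖ ≤ A δ * ∏ i, ‖x i‖)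
    {Φ R : ℕ → Cspace m → Cspace m} {φ : ℕ → ℝ} {k : ℕ}
    (hΦ : ∀ l, 1 ≤ l → l < k → HSPoly l (Φ l) (φ l))
    (hR : ∀ l, 2 ≤ l → l < k → HSPoly l (R l) (φ l)) :
    HSPoly k (homSource f Φ R k) (sourceBound A φ k) := by
  unfold NilpotentNF.homSource sourceBound
  simp only [sub_eq_add_neg]
  refine HSPoly.add (HSPoly.sum _ fun δ hδ => HSPoly.sum _ fun κ hκ => ?_)
    (HSPoly.neg (HSPoly.sum _ fun l hl => ?_))
  · obtain ⟨h1, h2⟩ := mem_comps.1 hκ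
    have := HSPoly.multilinear_comp (f δ) (hA δ) (hf δ (Finset.mem_Icc.1 hδ).1)
      (κ := κ) (P := fun i => Φ (κ i)) (B := fun i => φ (κ i)) fun i => by
        have := Finset.mem_Icc.1 (h1 i)
        exact hΦ _ this.1 (by omega)
    rwa [h2] at this
  · rw [Finset.mem_Icc] at hl
    exact HSPoly.fderiv_apply (hΦ l (by omega) (by omega)) (hR (k + 1 - l) (by omega) (by omega))
      (by omega)

/-- The terms of the normalizing transformation and of the normal form up to degree `p`. -/
theorem IsStandardNilpotent.exists_normalForm_terms {N : Cspace m →L[ℂ] Cspace m}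
    (hN : IsStandardNilpotent N)
    {f : (δ : ℕ) → ContinuousMultilinearMap ℂ (fun _ : Fin δ => Cspace m) (Cspace m)}
    {A : ℕ → ℝ} (hA : ∀ δ, 0 ≤ A δ) (hf : ∀ δ, 2 ≤ δ → ∀ x, ‖f δ x‖ ≤ A δ * ∏ i, ‖x i‖)
    (p : ℕ) :
    ∃ (Φ R : ℕ → Cspace m → Cspace m) (φ : ℕ → ℝ), Φ 1 = (fun y => y) ∧ φ 1 = Real.sqrt m ∧
      ∀ k, 2 ≤ k → k ≤ p → HSPoly k (Φ k) (φ k) ∧ HSPoly k (R k) (φ k) ∧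
        φ k = sourceBound A φ k ∧
        (∀ y, fderiv ℂ (Φ k) y (N y) - N (Φ k y) + R k y = homSource f Φ R k y) ∧
        ∀ y, fderiv ℂ (R k) y (ContinuousLinearMap.adjoint N y) =
          ContinuousLinearMap.adjoint N (R k y) := by
  induction p with
  | zero => exact ⟨fun _ y => y, fun _ y => y, fun _ => Real.sqrt m, rfl, rfl, by omega⟩
  | succ p ih =>
    obtain ⟨Φ, R, φ, hΦ1, hφ1, h⟩ := ih
    rcases Nat.lt_or_ge (p + 1) 2 with hp | hp
    · exact ⟨Φ, R, φ, hΦ1, hφ1, fun k h2 hk => by omega⟩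
    have hsrc : HSPoly (p + 1) (homSource f Φ R (p + 1)) (sourceBound A φ (p + 1)) := by
      refine HSPoly.homSource hA hf (fun l h1 hl => ?_) fun l h1 hl => (h l h1 (by omega)).2.1
      rcases h1.eq_or_lt with rfl | h1
      · rw [hΦ1, hφ1]; exact HSPoly.id
      · exact (h l h1 (by omega)).1
    obtain ⟨Ψ, S, hΨ, hS, heq, hadj⟩ := hN.exists_homological hsrc
    have hlt : ∀ {E : Type} (F : ℕ → E) (G : E) (l : ℕ), l < p + 1 →
        F l = Function.update F (p + 1) G l := fun F G l hl => by
      rw [Function.update_of_ne (by omega)]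
    refine ⟨Function.update Φ (p + 1) Ψ, Function.update R (p + 1) S,
      Function.update φ (p + 1) (sourceBound A φ (p + 1)), ?_, ?_, fun k h2 hk => ?_⟩
    · rw [← hlt _ _ _ (by omega), hΦ1]
    · rw [← hlt _ _ _ (by omega), hφ1]
    · have hs : ∀ y, homSource f (Function.update Φ (p + 1) Ψ) (Function.update R (p + 1) S) k y =
          homSource f Φ R k y := fun y =>
        (homSource_congr f (fun l hl => hlt _ _ l (by omega)) (fun l hl => hlt _ _ l (by omega))
          y).symm
      have hb : sourceBound A (Function.update φ (p + 1) (sourceBound A φ (p + 1))) k =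
          sourceBound A φ k :=
        (sourceBound_congr A fun l hl => hlt _ _ l (by omega)).symm
      simp only [hs, hb]
      rcases hk.eq_or_lt with rfl | hk
      · simp only [Function.update_self]
        exact ⟨hΨ, hS, trivial, heq, hadj⟩
      · rw [← hlt _ _ k hk, ← hlt _ _ k hk, ← hlt _ _ k hk]
        exact h k h2 (by omega)

/-! ### Rearrangement of sums -/

theorem le_sum_of_mem_comps {δ k : ℕ} {κ : Fin δ → ℕ} (hκ : κ ∈ comps δ k) : δ ≤ k := by
  obtain ⟨h1, h2⟩ := mem_comps.1 hκ
  calc δ = ∑ _i : Fin δ, 1 := by simp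
    _ ≤ ∑ i, κ i := Finset.sum_le_sum fun i _ => (Finset.mem_Icc.1 (h1 i)).1
    _ = k := h2

theorem sum_Icc_sum_comps {E : Type*} [AddCommMonoid E] {n k : ℕ} (hk : k ≤ n)
    (g : (δ : ℕ) → (Fin δ → ℕ) → E) :
    ∑ δ ∈ Finset.Icc 2 k, ∑ κ ∈ comps δ k, g δ κ =
      ∑ δ ∈ Finset.Icc 2 n, ∑ κ ∈ comps δ k, g δ κ := by
  refine Finset.sum_subset (Finset.Icc_subset_Icc_right hk) fun δ hδ hδ' => ?_
  rw [Finset.mem_Icc] at hδ hδ'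
  refine Finset.sum_eq_zero fun κ hκ => ?_
  have := le_sum_of_mem_comps hκ
  omega

/-- With at least two positive parts and total at most `K + 1`, each part is at most `K`. The case
`n = K + 1` serves the induction on the majorant, the case `n = K` the truncation error. -/
theorem sum_comps_eq {E : Type*} [AddCommMonoid E] {δ n K : ℕ} (hδ : 2 ≤ δ) (hn : n ≤ K + 1)
    (g : (Fin δ → ℕ) → E) :
    ∑ k ∈ Finset.Icc 2 n, ∑ κ ∈ comps δ k, g κ =
      ∑ κ ∈ Fintype.piFinset (fun _ : Fin δ => Finset.Icc 1 K) with ∑ i, κ i ≤ n, g κ := by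
  rw [Finset.sum_sigma']
  refine Finset.sum_bij' (fun x _ => x.2) (fun κ _ => ⟨∑ i, κ i, κ⟩) ?_ ?_ ?_ ?_ ?_
  · rintro ⟨k, κ⟩ h
    rw [Finset.mem_sigma, Finset.mem_Icc, mem_comps] at h
    obtain ⟨⟨h2, hk⟩, h3, h4⟩ := h
    replace h3 : ∀ i, κ i ∈ Finset.Icc 1 (k - 1) := h3
    replace hk : k ≤ n := hk
    replace h4 : ∑ i, κ i = k := h4
    rw [Finset.mem_filter, Fintype.mem_piFinset]
    refine ⟨fun i => ?_, h4.trans_le hk⟩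
    have := Finset.mem_Icc.1 (h3 i)
    exact Finset.mem_Icc.2 ⟨this.1, show κ i ≤ K by omega⟩
  · intro κ h
    rw [Finset.mem_filter, Fintype.mem_piFinset] at h
    obtain ⟨h1, h2⟩ := h
    have h1' : ∀ i, 1 ≤ κ i := fun i => (Finset.mem_Icc.1 (h1 i)).1
    have hsplit : ∀ i, κ i + 1 ≤ ∑ j, κ j := by
      intro i
      obtain ⟨j, hj⟩ : ∃ j : Fin δ, j ≠ i := by
        have : Nontrivial (Fin δ) := Fin.nontrivial_iff_two_le.2 hδ
        exact exists_ne i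
      calc κ i + 1 ≤ κ i + κ j := by have := h1' j; omega
        _ = ∑ l ∈ {i, j}, κ l := (Finset.sum_pair hj.symm).symm
        _ ≤ ∑ l, κ l := Finset.sum_le_sum_of_subset (Finset.subset_univ _)
    rw [Finset.mem_sigma, Finset.mem_Icc, mem_comps]
    have h0 := hsplit ⟨0, by omega⟩
    have h0' := h1' ⟨0, by omega⟩
    refine ⟨⟨by simp only; omega, h2⟩, fun i => ?_, rfl⟩
    rw [Finset.mem_Icc]
    have := hsplit i
    have := h1' i
    simp only
    omega
  · rintro ⟨k, κ⟩ h
    rw [Finset.mem_sigma, mem_comps] at h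
    obtain ⟨-, -, h4⟩ := h
    simp only at h4
    simp only [h4]
  · intro κ _; rfl
  · rintro ⟨k, κ⟩ _; rfl

theorem sum_sum_Icc_eq {E : Type*} [AddCommMonoid E] {n K : ℕ} (hn : n ≤ K + 1)
    (g : ℕ → ℕ → E) :
    ∑ k ∈ Finset.Icc 2 n, ∑ l ∈ Finset.Icc 2 (k - 1), g l (k + 1 - l) =
      ∑ x ∈ Finset.Icc 2 K ×ˢ Finset.Icc 2 K with x.1 + x.2 ≤ n + 1, g x.1 x.2 := by
  rw [Finset.sum_sigma']
  refine Finset.sum_bij' (fun x _ => (x.2, x.1 + 1 - x.2)) (fun x _ => ⟨x.1 + x.2 - 1, x.1⟩)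
    ?_ ?_ ?_ ?_ ?_
  · rintro ⟨k, l⟩ h
    simp only [Finset.mem_sigma, Finset.mem_Icc, Finset.mem_filter, Finset.mem_product] at h ⊢
    omega
  · rintro ⟨l, l'⟩ h
    simp only [Finset.mem_sigma, Finset.mem_Icc, Finset.mem_filter, Finset.mem_product] at h ⊢
    omega
  · rintro ⟨k, l⟩ h
    simp only [Finset.mem_sigma, Finset.mem_Icc] at h
    simp only [Sigma.mk.injEq, heq_eq_eq, and_true]
    omega
  · rintro ⟨l, l'⟩ h
    simp only [Finset.mem_Icc, Finset.mem_filter, Finset.mem_product] at h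
    simp only [Prod.mk.injEq, true_and]
    omega
  · rintro ⟨k, l⟩ _; rfl

theorem sum_Icc_one_eq_add {E : Type*} [AddCommMonoid E] {K : ℕ} (hK : 1 ≤ K) (ψ : ℕ → E) :
    ∑ k ∈ Finset.Icc 1 K, ψ k = ψ 1 + ∑ k ∈ Finset.Icc 2 K, ψ k := by
  rw [← Finset.add_sum_Ioc_eq_sum_Icc hK]
  congr 1

theorem sum_piFinset_prod (K δ : ℕ) (ψ : ℕ → ℝ) :
    ∑ κ ∈ Fintype.piFinset (fun _ : Fin δ => Finset.Icc 1 K), ∏ i, ψ (κ i) =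
      (∑ k ∈ Finset.Icc 1 K, ψ k) ^ δ := by
  rw [← Finset.prod_univ_sum (t := fun _ : Fin δ => Finset.Icc 1 K) (f := fun _ k => ψ k)]
  simp

/-! ### The majorant -/

theorem sum_Icc_pow_le {x y : ℝ} (hy : 0 ≤ y) (hyx : y ≤ x) (hx : x < 1) (n : ℕ) :
    ∑ δ ∈ Finset.Icc 2 n, y ^ δ ≤ x ^ 2 / (1 - x) := by
  have h1 : ∑ δ ∈ Finset.Icc 2 n, y ^ δ ≤ ∑ δ ∈ Finset.Icc 2 n, x ^ δ :=
    Finset.sum_le_sum fun δ _ => pow_le_pow_left₀ hy hyx δ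
  have h0 : 0 ≤ x := hy.trans hyx
  refine h1.trans ?_
  rw [le_div_iff₀ (by linarith)]
  induction n with
  | zero => simp; positivity
  | succ n ih =>
    have key : ∀ n : ℕ, 1 ≤ n → (∑ δ ∈ Finset.Icc 2 n, x ^ δ) * (1 - x) = x ^ 2 - x ^ (n + 1) := by
      intro n hn
      induction n, hn using Nat.le_induction with
      | base => simp
      | succ n hn ih =>
        rw [Finset.sum_Icc_succ_top (by omega), add_mul, ih]; ring
    rw [key (n + 1) (by omega)]
    have : 0 ≤ x ^ (n + 1 + 1) := by positivity
    linarith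

/-- A bootstrap on partial sums: the sum up to `K + 1` is bounded by the recursion evaluated on the
sum up to `K`, and `hmain` says that this evaluation maps the bound `b r²` below itself. -/
theorem sum_majorant_le {φ : ℕ → ℝ} {p : ℕ} {a c s b r : ℝ} (ha : 0 ≤ a) (hc : 0 ≤ c)
    (hr : 0 < r) (hφ1 : φ 1 = s) (hφ0 : ∀ k, 1 ≤ k → k ≤ p → 0 ≤ φ k)
    (hφ : ∀ k, 2 ≤ k → k ≤ p → φ k = sourceBound (fun δ => c * a ^ δ) φ k)
    (hs : 0 ≤ s) (hb : 0 ≤ b)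
    (hx : a * (s * r + b * r ^ 2) < 1)
    (hmain : c * ((a * (s * r + b * r ^ 2)) ^ 2 / (1 - a * (s * r + b * r ^ 2))) +
      p * b ^ 2 * r ^ 3 ≤ b * r ^ 2) {K : ℕ} (hK : K ≤ p) :
    ∑ k ∈ Finset.Icc 2 K, φ k * r ^ k ≤ b * r ^ 2 := by
  induction K with
  | zero => simp; positivity
  | succ K ih =>
    rcases Nat.eq_zero_or_pos K with rfl | hK0
    · simp; positivity
    have ih := ih (by omega)
    set U := ∑ k ∈ Finset.Icc 2 K, φ k * r ^ k with hU
    have hU0 : 0 ≤ U := Finset.sum_nonneg fun k hk => by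
      rw [Finset.mem_Icc] at hk
      exact mul_nonneg (hφ0 k (by omega) (by omega)) (by positivity)
    -- In the derivative terms the degrees satisfy `l + l' = k + 1`, whence the division by `r`.
    refine le_trans (le_of_eq ?_) ((add_le_add (a := ∑ k ∈ Finset.Icc 2 (K + 1),
      ∑ δ ∈ Finset.Icc 2 (K + 1), ∑ κ ∈ comps δ k, c * a ^ δ * ∏ i, (φ (κ i) * r ^ κ i))
      (c := ∑ k ∈ Finset.Icc 2 (K + 1), ∑ l ∈ Finset.Icc 2 (k - 1),
        (l * φ l * φ (k + 1 - l) * r ^ (l + (k + 1 - l)) / r)) ?_ ?_).trans hmain)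
    · rw [← Finset.sum_add_distrib]
      refine Finset.sum_congr rfl fun k hk => ?_
      rw [Finset.mem_Icc] at hk
      rw [hφ k hk.1 (by omega), sourceBound, ← sum_Icc_sum_comps hk.2
        (fun δ κ => c * a ^ δ * ∏ i, (φ (κ i) * r ^ κ i)), add_mul, Finset.sum_mul,
        Finset.sum_mul]
      congr 1
      · refine Finset.sum_congr rfl fun δ _ => ?_
        rw [Finset.sum_mul]
        refine Finset.sum_congr rfl fun κ hκ => ?_
        rw [Finset.prod_mul_distrib, Finset.prod_pow_eq_pow_sum, (mem_comps.1 hκ).2]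
        ring
      · refine Finset.sum_congr rfl fun l hl => ?_
        rw [Finset.mem_Icc] at hl
        rw [show l + (k + 1 - l) = k + 1 by omega, pow_succ]
        field_simp
    · rw [Finset.sum_comm]
      have h1 : ∀ δ ∈ Finset.Icc 2 (K + 1), ∑ k ∈ Finset.Icc 2 (K + 1), ∑ κ ∈ comps δ k,
          c * a ^ δ * ∏ i, (φ (κ i) * r ^ κ i) ≤ c * (a * (s * r + U)) ^ δ := by
        intro δ hδ
        rw [Finset.mem_Icc] at hδ
        rw [sum_comps_eq hδ.1 le_rfl, ← Finset.mul_sum, mul_pow, mul_assoc]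
        have hnn : ∀ κ ∈ Fintype.piFinset (fun _ : Fin δ => Finset.Icc 1 K),
            0 ≤ ∏ i, (φ (κ i) * r ^ κ i) := fun κ hκ => Finset.prod_nonneg fun i _ => by
          have := Finset.mem_Icc.1 (Fintype.mem_piFinset.1 hκ i)
          exact mul_nonneg (hφ0 _ this.1 (by omega)) (by positivity)
        have h2 : ∑ κ ∈ Fintype.piFinset (fun _ : Fin δ => Finset.Icc 1 K) with ∑ i, κ i ≤ K + 1,
            ∏ i, (φ (κ i) * r ^ κ i) ≤ (s * r + U) ^ δ := by
          refine (Finset.sum_le_sum_of_subset_of_nonneg (Finset.filter_subset _ _)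
            fun κ hκ _ => hnn κ hκ).trans (le_of_eq ?_)
          rw [sum_piFinset_prod K δ fun k => φ k * r ^ k, sum_Icc_one_eq_add hK0, hφ1, pow_one]
        gcongr
      refine (Finset.sum_le_sum h1).trans ?_
      rw [← Finset.mul_sum]
      refine mul_le_mul_of_nonneg_left (sum_Icc_pow_le (by positivity) ?_ hx _) hc
      gcongr
    · rw [sum_sum_Icc_eq (K := K) le_rfl (fun l l' => l * φ l * φ l' * r ^ (l + l') / r)]
      have hnn : ∀ x ∈ Finset.Icc 2 K ×ˢ Finset.Icc 2 K, 0 ≤ φ x.1 * φ x.2 := fun x hx => by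
        simp only [Finset.mem_product, Finset.mem_Icc] at hx
        exact mul_nonneg (hφ0 _ (by omega) (by omega)) (hφ0 _ (by omega) (by omega))
      calc _ ≤ ∑ x ∈ Finset.Icc 2 K ×ˢ Finset.Icc 2 K,
            (x.1 * φ x.1 * φ x.2 * r ^ (x.1 + x.2) / r : ℝ) :=
            Finset.sum_le_sum_of_subset_of_nonneg (Finset.filter_subset _ _) fun x hx _ => by
              have := hnn x hx
              rw [mul_assoc (x.1 : ℝ)]
              positivity
        _ ≤ ∑ x ∈ Finset.Icc 2 K ×ˢ Finset.Icc 2 K,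
            (p / r * ((φ x.1 * r ^ x.1) * (φ x.2 * r ^ x.2)) : ℝ) := by
            refine Finset.sum_le_sum fun x hx => ?_
            have h1 := hnn x hx
            simp only [Finset.mem_product, Finset.mem_Icc] at hx
            have h2 : (x.1 : ℝ) ≤ p := by exact_mod_cast (by omega : x.1 ≤ p)
            calc (x.1 * φ x.1 * φ x.2 * r ^ (x.1 + x.2) / r : ℝ)
                = x.1 * (φ x.1 * φ x.2 * (r ^ (x.1 + x.2) / r)) := by ring
              _ ≤ p * (φ x.1 * φ x.2 * (r ^ (x.1 + x.2) / r)) := by gcongr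
              _ = _ := by rw [pow_add]; ring
        _ = p / r * U ^ 2 := by
            rw [← Finset.mul_sum, hU, sq, Finset.sum_mul_sum, Finset.sum_product]
        _ ≤ p / r * (b * r ^ 2) ^ 2 := by gcongr
        _ = p * b ^ 2 * r ^ 3 := by field_simp

/-- `u` is a sum of homogeneous polynomial maps of degrees between `2` and `p`. -/
def IsHomSum (p : ℕ) (u : Cspace m → Cspace m) : Prop :=
  ∃ (Φ : ℕ → Cspace m → Cspace m) (φ : ℕ → ℝ),
    (∀ k ∈ Finset.Icc 2 p, HSPoly k (Φ k) (φ k)) ∧ ∀ y, u y = ∑ k ∈ Finset.Icc 2 p, Φ k y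

theorem IsHomSum.analyticAt {p : ℕ} {u : Cspace m → Cspace m} (h : IsHomSum p u) (y : Cspace m) :
    AnalyticAt ℂ u y := by
  obtain ⟨Φ, φ, hΦ, hu⟩ := h
  rw [show u = fun y => ∑ k ∈ Finset.Icc 2 p, Φ k y from funext hu]
  exact Finset.analyticAt_fun_sum _ fun k hk => (hΦ k hk).analyticAt y

theorem fderiv_sum_apply_of_HSPoly {s : Finset ℕ} {Φ : ℕ → Cspace m → Cspace m} {φ : ℕ → ℝ}
    (hΦ : ∀ k ∈ s, HSPoly k (Φ k) (φ k)) (y v : Cspace m) :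
    fderiv ℂ (fun y => ∑ k ∈ s, Φ k y) y v = ∑ k ∈ s, fderiv ℂ (Φ k) y v := by
  rw [fderiv_fun_sum fun k hk => (hΦ k hk).differentiable y]
  simp

/-! ### Terms of degree greater than `p` -/

section Error

variable {N : Cspace m →L[ℂ] Cspace m}
  {f : (δ : ℕ) → ContinuousMultilinearMap ℂ (fun _ : Fin δ => Cspace m) (Cspace m)}
  {Φ R : ℕ → Cspace m → Cspace m} {φ : ℕ → ℝ} {p : ℕ}

/-- The multilinear terms of degree at least `2`, evaluated on the sum of the `Φ k`. -/
theorem multilinear_sum_eq (Ψ : ℕ → Cspace m) :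
    ∑ δ ∈ Finset.Icc 2 p, f δ (fun _ => ∑ k ∈ Finset.Icc 1 p, Ψ k) =
      ∑ k ∈ Finset.Icc 2 p, ∑ δ ∈ Finset.Icc 2 k, ∑ κ ∈ comps δ k, f δ (fun i => Ψ (κ i)) +
      ∑ δ ∈ Finset.Icc 2 p,
        ∑ κ ∈ Fintype.piFinset (fun _ : Fin δ => Finset.Icc 1 p) with ¬ ∑ i, κ i ≤ p,
          f δ (fun i => Ψ (κ i)) := by
  have h1 : ∑ k ∈ Finset.Icc 2 p, ∑ δ ∈ Finset.Icc 2 k, ∑ κ ∈ comps δ k, f δ (fun i => Ψ (κ i)) =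
      ∑ δ ∈ Finset.Icc 2 p, ∑ k ∈ Finset.Icc 2 p, ∑ κ ∈ comps δ k, f δ (fun i => Ψ (κ i)) := by
    rw [Finset.sum_comm]
    refine Finset.sum_congr rfl fun k hk => ?_
    exact sum_Icc_sum_comps (Finset.mem_Icc.1 hk).2 fun δ κ => f δ (fun i => Ψ (κ i))
  rw [h1, ← Finset.sum_add_distrib]
  refine Finset.sum_congr rfl fun δ hδ => ?_
  rw [(f δ).map_sum_finset, sum_comps_eq (Finset.mem_Icc.1 hδ).1 (Nat.le_succ p),
    Finset.sum_filter_add_sum_filter_not]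

/-- The terms of degree larger than `p` in the conjugated vector field. -/
theorem error_eq (hΦ1 : Φ 1 = fun y => y) (hp : 1 ≤ p)
    (hΦ : ∀ k ∈ Finset.Icc 2 p, HSPoly k (Φ k) (φ k))
    (heq : ∀ k ∈ Finset.Icc 2 p, ∀ y,
      fderiv ℂ (Φ k) y (N y) - N (Φ k y) + R k y = homSource f Φ R k y) (y : Cspace m) :
    N (∑ k ∈ Finset.Icc 1 p, Φ k y) + ∑ δ ∈ Finset.Icc 2 p,
        f δ (fun _ => ∑ k ∈ Finset.Icc 1 p, Φ k y) -
      (N y + ∑ k ∈ Finset.Icc 2 p, R k y +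
        fderiv ℂ (fun y => ∑ k ∈ Finset.Icc 2 p, Φ k y) y
          (N y + ∑ k ∈ Finset.Icc 2 p, R k y)) =
      ∑ δ ∈ Finset.Icc 2 p,
        ∑ κ ∈ Fintype.piFinset (fun _ : Fin δ => Finset.Icc 1 p) with ¬ ∑ i, κ i ≤ p,
          f δ (fun i => Φ (κ i) y) -
      ∑ x ∈ Finset.Icc 2 p ×ˢ Finset.Icc 2 p with ¬ x.1 + x.2 ≤ p + 1,
        fderiv ℂ (Φ x.1) y (R x.2 y) := by
  have h1 := Finset.sum_congr (rfl : Finset.Icc 2 p = _) fun k hk => heq k hk y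
  simp only [homSource] at h1
  rw [Finset.sum_sub_distrib (f := fun k => ∑ δ ∈ Finset.Icc 2 k, ∑ κ ∈ comps δ k,
    f δ (fun i => Φ (κ i) y)), sum_sum_Icc_eq (Nat.le_succ p)
    fun l l' => fderiv ℂ (Φ l) y (R l' y)] at h1
  rw [multilinear_sum_eq, sum_Icc_one_eq_add hp, hΦ1, fderiv_sum_apply_of_HSPoly hΦ]
  have h2 : ∑ k ∈ Finset.Icc 2 p, fderiv ℂ (Φ k) y (∑ l ∈ Finset.Icc 2 p, R l y) =
      ∑ x ∈ Finset.Icc 2 p ×ˢ Finset.Icc 2 p with x.1 + x.2 ≤ p + 1,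
        fderiv ℂ (Φ x.1) y (R x.2 y) +
      ∑ x ∈ Finset.Icc 2 p ×ˢ Finset.Icc 2 p with ¬ x.1 + x.2 ≤ p + 1,
        fderiv ℂ (Φ x.1) y (R x.2 y) := by
    rw [Finset.sum_filter_add_sum_filter_not, Finset.sum_product]
    simp only [map_sum]
  simp only [map_add, Finset.sum_add_distrib, map_sum]
  simp only [map_sum] at h2
  rw [h2]
  simp only [Finset.sum_add_distrib, Finset.sum_sub_distrib] at h1
  have h3 := sub_eq_iff_eq_add.1 h1.symm
  rw [h3]
  abel

theorem norm_HSPoly_le {k : ℕ} {P : Cspace m → Cspace m} {B r t : ℝ} (h : HSPoly k P B)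
    {y : Cspace m} (hy : ‖y‖ = t * r) : ‖P y‖ ≤ B * r ^ k * t ^ k := by
  refine (h.norm_le y).trans (le_of_eq ?_)
  rw [hy, mul_pow]; ring

/-- Every remaining composition has total degree at least `p + 1`, so with `‖y‖ = t r` it gains `t ^
(p + 1)` over its value in the majorant at radius `r`. -/
theorem norm_compositions_le {a c r t M : ℝ} (ha : 0 ≤ a) (hc : 0 ≤ c) (hr : 0 < r) (ht : 0 ≤ t)
    (ht1 : t ≤ 1)
    (hf : ∀ δ, 2 ≤ δ → ∀ x, ‖f δ x‖ ≤ c * a ^ δ * ∏ i, ‖x i‖)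
    (hΦ : ∀ k ∈ Finset.Icc 1 p, HSPoly k (Φ k) (φ k))
    (hM : ∑ k ∈ Finset.Icc 1 p, φ k * r ^ k ≤ M) (hx : a * M < 1)
    {y : Cspace m} (hy : ‖y‖ = t * r) :
    ‖∑ δ ∈ Finset.Icc 2 p,
        ∑ κ ∈ Fintype.piFinset (fun _ : Fin δ => Finset.Icc 1 p) with ¬ ∑ i, κ i ≤ p,
          f δ (fun i => Φ (κ i) y)‖ ≤ t ^ (p + 1) * (c * ((a * M) ^ 2 / (1 - a * M))) := by
  have hφ0 : ∀ k ∈ Finset.Icc 1 p, 0 ≤ φ k * r ^ k := fun k hk =>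
    mul_nonneg (hΦ k hk).nonneg (by positivity)
  have hS0 : 0 ≤ ∑ k ∈ Finset.Icc 1 p, φ k * r ^ k := Finset.sum_nonneg hφ0
  have key : ∀ δ ∈ Finset.Icc 2 p,
      ‖∑ κ ∈ Fintype.piFinset (fun _ : Fin δ => Finset.Icc 1 p) with ¬ ∑ i, κ i ≤ p,
          f δ (fun i => Φ (κ i) y)‖ ≤
        t ^ (p + 1) * (c * (a * ∑ k ∈ Finset.Icc 1 p, φ k * r ^ k) ^ δ) := by
    intro δ hδ
    have hnn : ∀ κ ∈ Fintype.piFinset (fun _ : Fin δ => Finset.Icc 1 p),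
        0 ≤ t ^ (p + 1) * (c * a ^ δ * ∏ i, (φ (κ i) * r ^ κ i)) := fun κ hκ => by
      have : 0 ≤ ∏ i, (φ (κ i) * r ^ κ i) := Finset.prod_nonneg fun i _ =>
        hφ0 _ (Fintype.mem_piFinset.1 hκ i)
      positivity
    calc _ ≤ ∑ κ ∈ Fintype.piFinset (fun _ : Fin δ => Finset.Icc 1 p) with ¬ ∑ i, κ i ≤ p,
          t ^ (p + 1) * (c * a ^ δ * ∏ i, (φ (κ i) * r ^ κ i)) := by
          refine norm_sum_le_of_le _ fun κ hκ => ?_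
          rw [Finset.mem_filter, Fintype.mem_piFinset] at hκ
          have hprod : ∏ i, ‖Φ (κ i) y‖ ≤ (∏ i, (φ (κ i) * r ^ κ i)) * t ^ (p + 1) := by
            calc ∏ i, ‖Φ (κ i) y‖ ≤ ∏ i, (φ (κ i) * r ^ κ i * t ^ κ i) :=
                  Finset.prod_le_prod (fun i _ => norm_nonneg _) fun i _ =>
                    norm_HSPoly_le (hΦ _ (hκ.1 i)) hy
              _ = (∏ i, (φ (κ i) * r ^ κ i)) * t ^ (∑ i, κ i) := by
                  rw [Finset.prod_mul_distrib, Finset.prod_pow_eq_pow_sum]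
              _ ≤ (∏ i, (φ (κ i) * r ^ κ i)) * t ^ (p + 1) := by
                  refine mul_le_mul_of_nonneg_left
                    (pow_le_pow_of_le_one ht ht1 (by omega))
                    (Finset.prod_nonneg fun i _ => hφ0 _ (hκ.1 i))
          refine (hf δ (Finset.mem_Icc.1 hδ).1 _).trans ?_
          calc c * a ^ δ * ∏ i, ‖Φ (κ i) y‖
              ≤ c * a ^ δ * ((∏ i, (φ (κ i) * r ^ κ i)) * t ^ (p + 1)) := by gcongr
            _ = _ := by ring
      _ ≤ ∑ κ ∈ Fintype.piFinset (fun _ : Fin δ => Finset.Icc 1 p),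
          t ^ (p + 1) * (c * a ^ δ * ∏ i, (φ (κ i) * r ^ κ i)) :=
          Finset.sum_le_sum_of_subset_of_nonneg (Finset.filter_subset _ _)
            fun κ hκ _ => hnn κ hκ
      _ = _ := by
          rw [← Finset.mul_sum, ← Finset.mul_sum, sum_piFinset_prod p δ fun k => φ k * r ^ k,
            mul_pow, mul_assoc]
  refine (norm_sum_le_of_le _ key).trans ?_
  rw [← Finset.mul_sum, ← Finset.mul_sum]
  have := sum_Icc_pow_le (mul_nonneg ha hS0) (mul_le_mul_of_nonneg_left hM ha) hx p
  gcongr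

/-- The surviving products have degree `l + l' - 1 ≥ p + 1`, which gives the power of `t`;
differentiation costs at most `p / r`. -/
theorem norm_fderiv_products_le {r t b : ℝ} (hr : 0 < r) (ht : 0 ≤ t) (ht1 : t ≤ 1)
    (hΦ : ∀ k ∈ Finset.Icc 2 p, HSPoly k (Φ k) (φ k))
    (hR : ∀ k ∈ Finset.Icc 2 p, HSPoly k (R k) (φ k))
    (hb : ∑ k ∈ Finset.Icc 2 p, φ k * r ^ k ≤ b * r ^ 2)
    {y : Cspace m} (hy : ‖y‖ = t * r) :
    ‖∑ x ∈ Finset.Icc 2 p ×ˢ Finset.Icc 2 p with ¬ x.1 + x.2 ≤ p + 1,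
        fderiv ℂ (Φ x.1) y (R x.2 y)‖ ≤ t ^ (p + 1) * (p * b ^ 2 * r ^ 3) := by
  have hφ0 : ∀ k ∈ Finset.Icc 2 p, 0 ≤ φ k * r ^ k := fun k hk =>
    mul_nonneg (hΦ k hk).nonneg (by positivity)
  calc _ ≤ ∑ x ∈ Finset.Icc 2 p ×ˢ Finset.Icc 2 p with ¬ x.1 + x.2 ≤ p + 1,
        t ^ (p + 1) * (p / r * ((φ x.1 * r ^ x.1) * (φ x.2 * r ^ x.2))) := by
        refine norm_sum_le_of_le _ fun x hx => ?_
        rw [Finset.mem_filter, Finset.mem_product] at hx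
        obtain ⟨⟨h1, h2⟩, h3⟩ := hx
        have hB := (hΦ _ h1).nonneg
        have hB' := (hR _ h2).nonneg
        refine ((hΦ _ h1).norm_fderiv_apply_le y _).trans ?_
        have h4 := norm_HSPoly_le (hR _ h2) hy
        rw [Finset.mem_Icc] at h1 h2
        have h5 : (x.1 : ℝ) ≤ p := by exact_mod_cast h1.2
        calc x.1 * φ x.1 * ‖y‖ ^ (x.1 - 1) * ‖R x.2 y‖
            ≤ p * φ x.1 * ‖y‖ ^ (x.1 - 1) * (φ x.2 * r ^ x.2 * t ^ x.2) := by gcongr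
          _ = t ^ (x.1 - 1 + x.2) * (p * φ x.1 * r ^ (x.1 - 1) * (φ x.2 * r ^ x.2)) := by
              rw [hy, mul_pow, pow_add]; ring
          _ ≤ t ^ (p + 1) * (p * φ x.1 * r ^ (x.1 - 1) * (φ x.2 * r ^ x.2)) := by
              refine mul_le_mul_of_nonneg_right
                (pow_le_pow_of_le_one ht ht1 (by omega)) (by positivity)
          _ = _ := by
              obtain ⟨n, hn⟩ : ∃ n, x.1 = n + 1 := ⟨x.1 - 1, by omega⟩
              rw [hn, Nat.add_sub_cancel, pow_succ r]
              field_simp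
    _ ≤ ∑ x ∈ Finset.Icc 2 p ×ˢ Finset.Icc 2 p,
        t ^ (p + 1) * (p / r * ((φ x.1 * r ^ x.1) * (φ x.2 * r ^ x.2))) := by
        refine Finset.sum_le_sum_of_subset_of_nonneg (Finset.filter_subset _ _) fun x hx _ => ?_
        rw [Finset.mem_product] at hx
        have h1 := hφ0 _ hx.1
        have h2 := hφ0 _ hx.2
        positivity
    _ = t ^ (p + 1) * (p / r * (∑ k ∈ Finset.Icc 2 p, φ k * r ^ k) ^ 2) := by
        rw [← Finset.mul_sum, ← Finset.mul_sum, sq, Finset.sum_mul_sum, Finset.sum_product]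
    _ ≤ t ^ (p + 1) * (p / r * (b * r ^ 2) ^ 2) := by
        have := Finset.sum_nonneg hφ0
        gcongr
    _ = _ := by field_simp

/-- Differentiation costs at most `p / r`, so the derivative stays bounded when `r` is of order `1 /
p`. -/
theorem norm_fderiv_sum_le {r b : ℝ} (hr : 0 < r)
    (hΦ : ∀ k ∈ Finset.Icc 2 p, HSPoly k (Φ k) (φ k))
    (hb : ∑ k ∈ Finset.Icc 2 p, φ k * r ^ k ≤ b * r ^ 2)
    {y : Cspace m} (hy : ‖y‖ ≤ r) (hb0 : 0 ≤ b) :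
    ‖fderiv ℂ (fun y => ∑ k ∈ Finset.Icc 2 p, Φ k y) y‖ ≤ p * b * r := by
  refine ContinuousLinearMap.opNorm_le_bound _ (by positivity) fun v => ?_
  rw [fderiv_sum_apply_of_HSPoly hΦ]
  calc _ ≤ ∑ k ∈ Finset.Icc 2 p, p / r * (φ k * r ^ k) * ‖v‖ := by
        refine norm_sum_le_of_le _ fun k hk => ?_
        have hB := (hΦ _ hk).nonneg
        refine ((hΦ _ hk).norm_fderiv_apply_le y _).trans ?_
        rw [Finset.mem_Icc] at hk
        have h5 : (k : ℝ) ≤ p := by exact_mod_cast hk.2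
        calc k * φ k * ‖y‖ ^ (k - 1) * ‖v‖ ≤ p * φ k * r ^ (k - 1) * ‖v‖ := by gcongr
          _ = _ := by
              obtain ⟨n, rfl⟩ : ∃ n, k = n + 1 := ⟨k - 1, by omega⟩
              rw [Nat.add_sub_cancel, pow_succ]
              field_simp
    _ = p / r * (∑ k ∈ Finset.Icc 2 p, φ k * r ^ k) * ‖v‖ := by
        rw [← Finset.sum_mul, ← Finset.mul_sum]
    _ ≤ p / r * (b * r ^ 2) * ‖v‖ := by gcongr
    _ = _ := by field_simp

end Error

/-! ### Normal forms on balls of radius proportional to `1 / p` -/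

/-- The normal form of order `p` on the ball of radius `r`, when the majorant closes there. -/
theorem IsStandardNilpotent.exists_normalForm_of_majorant {N : Cspace m →L[ℂ] Cspace m}
    (hN : IsStandardNilpotent N)
    {f : (δ : ℕ) → ContinuousMultilinearMap ℂ (fun _ : Fin δ => Cspace m) (Cspace m)}
    {a c : ℝ} (ha : 0 ≤ a) (hc : 0 ≤ c)
    (hf : ∀ δ, 2 ≤ δ → ∀ x, ‖f δ x‖ ≤ c * a ^ δ * ∏ i, ‖x i‖)
    {X : Cspace m → Cspace m} {U : Set (Cspace m)} {ρ : ℝ}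
    (hX : ∀ x, ‖x‖ < ρ → x ∈ U ∧ HasSum (fun δ : ℕ => f (δ + 2) fun _ => x) (X x - N x))
    {p : ℕ} (hp : 1 ≤ p) :
    ∃ u R : Cspace m → Cspace m, IsHomSum p u ∧ IsHomSum p R ∧
      (∀ y, fderiv ℂ R y (ContinuousLinearMap.adjoint N y) =
        ContinuousLinearMap.adjoint N (R y)) ∧
      ∀ r b : ℝ, 0 < r → 0 ≤ b → Real.sqrt m * r + b * r ^ 2 < ρ →
        a * (Real.sqrt m * r + b * r ^ 2) < 1 →
        c * ((a * (Real.sqrt m * r + b * r ^ 2)) ^ 2 /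
          (1 - a * (Real.sqrt m * r + b * r ^ 2))) + p * b ^ 2 * r ^ 3 ≤ b * r ^ 2 →
        ∀ y, ‖y‖ < r → y + u y ∈ U ∧ ‖fderiv ℂ u y‖ ≤ p * b * r ∧
          ‖X (y + u y) - (N y + R y + fderiv ℂ u y (N y + R y))‖ ≤
            2 * (b * r ^ 2) * (‖y‖ / r) ^ (p + 1) := by
  obtain ⟨Φ, R, φ, hΦ1, hφ1, h⟩ := hN.exists_normalForm_terms
    (A := fun δ => c * a ^ δ) (fun δ => by positivity) hf p
  have hΦ : ∀ k ∈ Finset.Icc 2 p, HSPoly k (Φ k) (φ k) := fun k hk =>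
    (h k (Finset.mem_Icc.1 hk).1 (Finset.mem_Icc.1 hk).2).1
  have hR : ∀ k ∈ Finset.Icc 2 p, HSPoly k (R k) (φ k) := fun k hk =>
    (h k (Finset.mem_Icc.1 hk).1 (Finset.mem_Icc.1 hk).2).2.1
  have hΦ' : ∀ k ∈ Finset.Icc 1 p, HSPoly k (Φ k) (φ k) := fun k hk => by
    rw [Finset.mem_Icc] at hk
    rcases hk.1.eq_or_lt with rfl | h1
    · rw [hΦ1, hφ1]; exact HSPoly.id
    · exact (h k h1 hk.2).1
  refine ⟨fun y => ∑ k ∈ Finset.Icc 2 p, Φ k y, fun y => ∑ k ∈ Finset.Icc 2 p, R k y,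
    ⟨Φ, φ, hΦ, fun _ => rfl⟩, ⟨R, φ, hR, fun _ => rfl⟩, fun y => ?_, ?_⟩
  · rw [fderiv_sum_apply_of_HSPoly hR, map_sum]
    refine Finset.sum_congr rfl fun k hk => ?_
    rw [Finset.mem_Icc] at hk
    exact (h k hk.1 hk.2).2.2.2.2 y
  intro r b hr hb hρ hx hmain y hy
  set M := Real.sqrt m * r + b * r ^ 2 with hM
  have hM0 : 0 ≤ M := by positivity
  have hsum := sum_majorant_le ha hc hr hφ1
    (fun k h1 h2 => (hΦ' k (Finset.mem_Icc.2 ⟨h1, h2⟩)).nonneg)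
    (fun k h1 h2 => (h k h1 h2).2.2.1) (Real.sqrt_nonneg _) hb hx hmain (le_refl p)
  have hsum1 : ∑ k ∈ Finset.Icc 1 p, φ k * r ^ k ≤ M := by
    rw [sum_Icc_one_eq_add hp, hφ1, pow_one]
    linarith
  set t := ‖y‖ / r with ht
  have hyt : ‖y‖ = t * r := by rw [ht]; field_simp
  have ht0 : 0 ≤ t := by positivity
  have ht1 : t ≤ 1 := by rw [ht, div_le_one hr]; exact hy.le
  have hsplit : y + ∑ k ∈ Finset.Icc 2 p, Φ k y = ∑ k ∈ Finset.Icc 1 p, Φ k y := by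
    rw [sum_Icc_one_eq_add hp, hΦ1]
  have hΨ : ‖∑ k ∈ Finset.Icc 1 p, Φ k y‖ ≤ t * M := by
    calc _ ≤ ∑ k ∈ Finset.Icc 1 p, t * (φ k * r ^ k) := by
          refine norm_sum_le_of_le _ fun k hk => (norm_HSPoly_le (hΦ' k hk) hyt).trans ?_
          have h0 := (hΦ' k hk).nonneg
          rw [mul_comm]
          refine mul_le_mul_of_nonneg_right ?_ (by positivity)
          exact pow_le_of_le_one ht0 ht1 (by have := (Finset.mem_Icc.1 hk).1; omega)
      _ ≤ t * M := by
          rw [← Finset.mul_sum]; gcongr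
  have htM : t * M < ρ := (mul_le_of_le_one_left hM0 ht1).trans_lt hρ
  obtain ⟨hU, hS⟩ := hX _ (hΨ.trans_lt htM)
  simp only
  rw [hsplit]
  refine ⟨hU, norm_fderiv_sum_le hr hΦ hsum hy.le hb, ?_⟩
  have herr := error_eq (N := N) (f := f) hΦ1 hp hΦ
    (fun k hk => (h k (Finset.mem_Icc.1 hk).1 (Finset.mem_Icc.1 hk).2).2.2.2.1) y
  set Ψ := ∑ k ∈ Finset.Icc 1 p, Φ k y with hΨdef
  have hx0 : 0 ≤ a * M := by positivity
  have htx : t * (a * M) ≤ a * M := mul_le_of_le_one_left hx0 ht1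
  have htail : ‖(∑ δ ∈ Finset.Icc 2 p, f δ fun _ => Ψ) - (X Ψ - N Ψ)‖ ≤
      t ^ (p + 1) * (c * ((a * M) ^ 2 / (1 - a * M))) := by
    -- The partial sum over `range (p - 1)` stops at `δ = p`, because the series starts at `δ = 2`.
    have hgeo := norm_sub_le_of_geometric_bound_of_hasSum (r := t * (a * M))
      (C := c * (t * (a * M)) ^ 2) (by linarith) (fun n => ?_) hS (p - 1)
    · have hre : ∑ n ∈ Finset.range (p - 1), f (n + 2) (fun _ => Ψ) =
          ∑ δ ∈ Finset.Icc 2 p, f δ fun _ => Ψ := by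
        rw [Finset.range_eq_Ico, Finset.sum_Ico_add' (fun δ => f δ fun _ => Ψ) 0 (p - 1) 2]
        rw [show Finset.Ico (0 + 2) (p - 1 + 2) = Finset.Icc 2 p by
          ext δ; simp only [Finset.mem_Ico, Finset.mem_Icc]; omega]
      rw [hre] at hgeo
      refine hgeo.trans ?_
      have e1 : c * (t * (a * M)) ^ 2 * (t * (a * M)) ^ (p - 1) =
          t ^ (p + 1) * (c * (a * M) ^ (p + 1)) := by
        obtain ⟨q, rfl⟩ : ∃ q, p = q + 1 := ⟨p - 1, by omega⟩
        rw [Nat.add_sub_cancel]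
        generalize a * M = Y
        ring
      rw [e1, mul_div_assoc, mul_div_assoc]
      have h1 : (a * M) ^ (p + 1) ≤ (a * M) ^ 2 := pow_le_pow_of_le_one hx0 hx.le (by omega)
      have h2 : 1 - a * M ≤ 1 - t * (a * M) := by linarith
      have h3 : 0 < 1 - a * M := by linarith
      gcongr
    · refine (hf (n + 2) (by omega) _).trans ?_
      simp only [Finset.prod_const, Finset.card_univ, Fintype.card_fin]
      calc c * a ^ (n + 2) * ‖Ψ‖ ^ (n + 2) ≤ c * a ^ (n + 2) * (t * M) ^ (n + 2) := by gcongr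
        _ = c * (t * (a * M)) ^ (n + 2) := by
            rw [mul_assoc c, ← mul_pow, mul_left_comm a t M]
        _ = _ := by rw [mul_assoc, ← pow_add, add_comm 2 n]
  have h1 := norm_compositions_le ha hc hr ht0 ht1 hf hΦ' hsum1 hx hyt
  have h2 := norm_fderiv_products_le hr ht0 ht1 hΦ hR hsum hyt
  have hE : X Ψ - (N y + ∑ k ∈ Finset.Icc 2 p, R k y +
        fderiv ℂ (fun y => ∑ k ∈ Finset.Icc 2 p, Φ k y) y
          (N y + ∑ k ∈ Finset.Icc 2 p, R k y)) =
      -((∑ δ ∈ Finset.Icc 2 p, f δ fun _ => Ψ) - (X Ψ - N Ψ)) +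
      (∑ δ ∈ Finset.Icc 2 p,
        ∑ κ ∈ Fintype.piFinset (fun _ : Fin δ => Finset.Icc 1 p) with ¬ ∑ i, κ i ≤ p,
          f δ (fun i => Φ (κ i) y) -
      ∑ x ∈ Finset.Icc 2 p ×ˢ Finset.Icc 2 p with ¬ x.1 + x.2 ≤ p + 1,
        fderiv ℂ (Φ x.1) y (R x.2 y)) := by
    rw [← herr]; abel
  rw [hE]
  refine (norm_add_le _ _).trans ?_
  rw [norm_neg]
  refine (add_le_add htail ((norm_sub_le _ _).trans (add_le_add h1 h2))).trans ?_
  -- The geometric term occurs twice and the derivative term once, so twice the majorant inequality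
  -- suffices.
  have h3 : 0 ≤ p * b ^ 2 * r ^ 3 := by positivity
  have h4 : 0 ≤ t ^ (p + 1) := by positivity
  nlinarith

/-- Divided by `r²`, the inequality tends to `n c a² + τ b² ≤ b` as `r → 0`. The choice `b = 2 n c
a²` allows the largest `τ` and makes it strict exactly when `4 n c a² τ < 1`. -/
theorem eventually_majorant {n c a s b τ ρ : ℝ} (hn : 0 < n) (hc : 0 < c) (ha : 0 < a)
    (hs : s ^ 2 = n) (hb : b = 2 * (n * c * a ^ 2))
    (hτ : 4 * (n * c * a ^ 2) * τ < 1) (hρ : 0 < ρ) :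
    ∀ᶠ r in 𝓝 (0 : ℝ), s * r + b * r ^ 2 < ρ ∧ a * (s * r + b * r ^ 2) < 1 ∧
      c * ((a * (s * r + b * r ^ 2)) ^ 2 / (1 - a * (s * r + b * r ^ 2))) +
        τ * b ^ 2 * r ^ 2 ≤ b * r ^ 2 := by
  have hq : 0 < n * c * a ^ 2 := by positivity
  have t1 : Tendsto (fun r : ℝ => s * r + b * r ^ 2) (𝓝 0) (𝓝 0) := by
    have : Continuous fun r : ℝ => s * r + b * r ^ 2 := by fun_prop
    simpa using this.tendsto 0
  have t2 : Tendsto (fun r : ℝ => a * (s * r + b * r ^ 2)) (𝓝 0) (𝓝 0) := by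
    simpa using t1.const_mul a
  have t3 : Tendsto (fun r : ℝ => c * ((a * (s + b * r)) ^ 2 / (1 - a * (s * r + b * r ^ 2))) +
      τ * b ^ 2) (𝓝 0) (𝓝 (c * ((a * s) ^ 2 / (1 - 0)) + τ * b ^ 2)) := by
    have h1 : Tendsto (fun r : ℝ => (a * (s + b * r)) ^ 2) (𝓝 0) (𝓝 ((a * s) ^ 2)) := by
      have : Continuous fun r : ℝ => (a * (s + b * r)) ^ 2 := by fun_prop
      simpa using this.tendsto 0
    exact ((h1.div (t2.const_sub 1) (by norm_num)).const_mul c).add_const _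
  have hlt : c * ((a * s) ^ 2 / (1 - 0)) + τ * b ^ 2 < b := by
    rw [sub_zero, div_one, mul_pow, hs, hb]
    nlinarith
  filter_upwards [t1.eventually_lt_const hρ, t2.eventually_lt_const one_pos,
    t3.eventually_lt_const hlt] with r h1 h2 h3
  refine ⟨h1, h2, ?_⟩
  have h4 := mul_le_mul_of_nonneg_right h3.le (sq_nonneg r)
  refine le_trans (le_of_eq ?_) h4
  rw [show a * (s * r + b * r ^ 2) = a * (s + b * r) * r by ring, mul_pow]
  ring

theorem isUnit_one_add_of_norm_le {A : Cspace m →L[ℂ] Cspace m} {θ : ℝ} (h : ‖A‖ ≤ θ)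
    (hθ : θ < 1) : IsUnit (1 + A) := by
  have := isUnit_one_sub_of_norm_lt_one (x := -A) (by rw [norm_neg]; exact h.trans_lt hθ)
  rwa [sub_neg_eq_add] at this

theorem isInvertible_of_isUnit {A : Cspace m →L[ℂ] Cspace m} (h : IsUnit A) : A.IsInvertible := by
  obtain ⟨v, rfl⟩ := h
  exact ⟨ContinuousLinearEquiv.unitsEquiv ℂ _ v, rfl⟩

/-- Normal forms of all large orders `p` on the balls of radius `τ / p`, for a vector field whose
linear part is a standard nilpotent operator. -/
theorem IsStandardNilpotent.exists_normalForm (hm : 0 < m) {N : Cspace m →L[ℂ] Cspace m}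
    (hN : IsStandardNilpotent N)
    {f : (δ : ℕ) → ContinuousMultilinearMap ℂ (fun _ : Fin δ => Cspace m) (Cspace m)}
    {a c : ℝ} (ha : 0 < a) (hc : 0 < c)
    (hf : ∀ δ, 2 ≤ δ → ∀ x, ‖f δ x‖ ≤ c * a ^ δ * ∏ i, ‖x i‖)
    {X : Cspace m → Cspace m} {U : Set (Cspace m)} (hU : IsOpen U) (h0U : (0 : Cspace m) ∈ U)
    (hX : AnalyticOnNhd ℂ X U)
    (hXf : ∀ᶠ x in 𝓝 (0 : Cspace m), HasSum (fun δ : ℕ => f (δ + 2) fun _ => x) (X x - N x))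
    {τ : ℝ} (hτ0 : 0 < τ) (hτ : 4 * (m * c * a ^ 2) * τ < 1) :
    ∃ u R T : ℕ → Cspace m → Cspace m, ∃ K : ℝ, 0 < K ∧ ∀ᶠ p : ℕ in atTop,
      IsHomSum p (u p) ∧ IsHomSum p (R p) ∧
      Set.InjOn (fun y => y + u p y) (Metric.ball 0 (τ / p)) ∧
      Set.MapsTo (fun y => y + u p y) (Metric.ball 0 (τ / p)) U ∧
      (∀ y ∈ Metric.ball (0 : Cspace m) (τ / p),
        (fderiv ℂ (fun z => z + u p z) y).IsInvertible) ∧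
      AnalyticOnNhd ℂ (T p) (Metric.ball 0 (τ / p)) ∧
      (∀ y ∈ Metric.ball (0 : Cspace m) (τ / p),
        fderiv ℂ (fun z => z + u p z) y (N y + R p y + T p y) = X (y + u p y)) ∧
      (∀ y ∈ Metric.ball (0 : Cspace m) (τ / p), ‖T p y‖ ≤ K * (‖y‖ / (τ / p)) ^ (p + 1)) ∧
      ∀ y, fderiv ℂ (R p) y (ContinuousLinearMap.adjoint N y) =
        ContinuousLinearMap.adjoint N (R p y) := by
  obtain ⟨ρ, hρ0, hρ⟩ := Metric.eventually_nhds_iff_ball.1 ((hU.eventually_mem h0U).and hXf)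
  have hρ' : ∀ x, ‖x‖ < ρ → x ∈ U ∧ HasSum (fun δ : ℕ => f (δ + 2) fun _ => x) (X x - N x) :=
    fun x hx => hρ x (by simpa using hx)
  have hex : ∀ p : ℕ, ∃ u R : Cspace m → Cspace m, 1 ≤ p → _ := fun p => by
    by_cases hp : 1 ≤ p
    · obtain ⟨u, R, h⟩ := hN.exists_normalForm_of_majorant ha.le hc.le hf hρ' hp
      exact ⟨u, R, fun _ => h⟩
    · exact ⟨fun _ => 0, fun _ => 0, fun h => absurd h hp⟩
  choose u R huR using hex
  set b : ℝ := 2 * (m * c * a ^ 2) with hb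
  have hm' : (0 : ℝ) < m := by exact_mod_cast hm
  have hb0 : 0 < b := by positivity
  have htend : Tendsto (fun p : ℕ => τ / (p : ℝ)) atTop (𝓝 0) :=
    tendsto_const_div_atTop_nhds_zero_nat τ
  have hev := htend.eventually (eventually_majorant hm' hc ha (Real.sq_sqrt hm'.le) hb hτ hρ0)
  -- `T p` is obtained by solving the conjugation equation; `Ring.inverse` is total, and is a true
  -- inverse on the ball because `‖Du‖ ≤ 1/2` there.
  refine ⟨u, R, fun p y => Ring.inverse (fderiv ℂ (fun z => z + u p z) y) (X (y + u p y)) -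
    N y - R p y, 4 * (b * τ ^ 2), by positivity, ?_⟩
  filter_upwards [hev, eventually_ge_atTop 1] with p ⟨h1, h2, h3⟩ hp
  obtain ⟨hu, hR, hadj, hmain⟩ := huR p hp
  have hp0 : (0 : ℝ) < p := by exact_mod_cast hp
  set r := τ / (p : ℝ) with hr
  have hr0 : 0 < r := by positivity
  have hpr : p * r = τ := by rw [hr]; field_simp
  have hmaj := hmain r b hr0 hb0.le h1 h2 (le_trans (le_of_eq (by rw [← hpr]; ring)) h3)
  -- The left side is `b τ = 2 m c a² τ`, so this is again the condition on `τ`.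
  have hθ : p * b * r ≤ 1 / 2 := by
    have : p * b * r = τ * b := by rw [← hpr]; ring
    rw [this, hb]; linarith
  have hua : ∀ y, AnalyticAt ℂ (u p) y := hu.analyticAt
  have hfd : ∀ y, fderiv ℂ (fun z => z + u p z) y = 1 + fderiv ℂ (u p) y := fun y => by
    rw [fderiv_fun_add differentiableAt_fun_id (hua y).differentiableAt, fderiv_fun_id]
    rfl
  have hball : ∀ y ∈ Metric.ball (0 : Cspace m) r, ‖y‖ < r := fun y hy => by simpa using hy
  have hDu : ∀ y ∈ Metric.ball (0 : Cspace m) r, ‖fderiv ℂ (u p) y‖ ≤ 1 / 2 := fun y hy =>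
    (hmaj y (hball y hy)).2.1.trans hθ
  have hunit : ∀ y ∈ Metric.ball (0 : Cspace m) r, IsUnit (fderiv ℂ (fun z => z + u p z) y) :=
    fun y hy => by
      rw [hfd]
      exact isUnit_one_add_of_norm_le (hDu y hy) (by norm_num)
  have heq : ∀ y ∈ Metric.ball (0 : Cspace m) r,
      fderiv ℂ (fun z => z + u p z) y (N y + R p y + (Ring.inverse
        (fderiv ℂ (fun z => z + u p z) y) (X (y + u p y)) - N y - R p y)) = X (y + u p y) :=
    fun y hy => by
      rw [show ∀ v w z : Cspace m, v + w + (z - v - w) = z from fun v w z => by abel,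
        ← mul_apply_eq_comp, Ring.mul_inverse_cancel _ (hunit y hy)]
      rfl
  refine ⟨hu, hR, ?_, fun y hy => (hmaj y (hball y hy)).1,
    fun y hy => isInvertible_of_isUnit (hunit y hy), ?_, heq, ?_, hadj⟩
  · intro y hy z hz hyz
    have h4 := (convex_ball (0 : Cspace m) r).norm_image_sub_le_of_norm_fderiv_le
      (fun x _ => (hua x).differentiableAt) hDu hz hy
    have h5 : u p y - u p z = z - y := by
      have : y + u p y = z + u p z := hyz
      rw [sub_eq_sub_iff_add_eq_add, add_comm, this, add_comm]
    rw [h5, norm_sub_rev] at h4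
    have h6 : ‖y - z‖ ≤ 0 := by linarith
    exact sub_eq_zero.1 (norm_le_zero_iff.1 h6)
  · intro y hy
    have hg : AnalyticAt ℂ (fun z => z + u p z) y := analyticAt_id.fun_add (hua y)
    have hinv : AnalyticAt ℂ (fun y => Ring.inverse (fderiv ℂ (fun z => z + u p z) y)) y := by
      have h4 : AnalyticAt ℂ Ring.inverse (fderiv ℂ (fun z => z + u p z) y) := by
        obtain ⟨v, hv⟩ := hunit y hy
        rw [← hv]; exact analyticAt_inverse v
      exact h4.comp hg.fderiv
    have hXc : AnalyticAt ℂ (fun y => X (y + u p y)) y :=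
      AnalyticAt.comp (hX _ (hmaj y (hball y hy)).1) hg
    have happ := AnalyticAt.comp₂ ((ContinuousLinearMap.id ℂ (Cspace m →L[ℂ] Cspace m)).analyticAt_bilinear
      (Ring.inverse (fderiv ℂ (fun z => z + u p z) y), X (y + u p y))) hinv hXc
    exact (happ.fun_sub (N.analyticAt y)).fun_sub (hR.analyticAt y)
  · intro y hy
    set t := Ring.inverse (fderiv ℂ (fun z => z + u p z) y) (X (y + u p y)) - N y - R p y with ht
    have h4 := heq y hy
    rw [← ht, map_add, hfd] at h4
    have h5 : t = X (y + u p y) - (N y + R p y + fderiv ℂ (u p) y (N y + R p y)) -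
        fderiv ℂ (u p) y t := by
      rw [← h4]
      simp only [add_apply, one_apply_eq_self]
      abel
    -- The term `Du t` is absorbed in the left side, doubling the constant; bounding `r` by `τ`
    -- afterwards makes it independent of `p`.
    have h6 : ‖t‖ ≤ 2 * (b * r ^ 2) * (‖y‖ / r) ^ (p + 1) + 1 / 2 * ‖t‖ := by
      calc ‖t‖ = ‖X (y + u p y) - (N y + R p y + fderiv ℂ (u p) y (N y + R p y)) -
            fderiv ℂ (u p) y t‖ := by rw [← h5]
        _ ≤ _ := (norm_sub_le _ _).trans (add_le_add (hmaj y (hball y hy)).2.2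
            ((ContinuousLinearMap.le_opNorm _ _).trans
              (mul_le_mul_of_nonneg_right (hDu y hy) (norm_nonneg _))))
    have h7 : r ≤ τ := by
      rw [hr]; exact div_le_self hτ0.le (by exact_mod_cast hp)
    have h8 : 4 * (b * r ^ 2) * (‖y‖ / r) ^ (p + 1) ≤ 4 * (b * τ ^ 2) * (‖y‖ / r) ^ (p + 1) := by
      gcongr
    linarith

/-- Substituting linear forms for the variables and composing with a linear map preserve
homogeneity, hence the range of degrees. -/
theorem IsHomSum.isPolyMap_conj {p : ℕ} {u : Cspace m → Cspace m} (h : IsHomSum p u)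
    (S Q : Cspace m →L[ℂ] Cspace m) : IsPolyMap 2 p fun y => S (u (Q y)) := by
  obtain ⟨Φ, φ, hΦ, hu⟩ := h
  have hex : ∀ k, ∃ c : Tensor m (Fin k), k ∈ Finset.Icc 2 p → ∀ y, Φ k y = c.toML fun _ => y :=
    fun k => by
      by_cases hk : k ∈ Finset.Icc 2 p
      · obtain ⟨c, -, hc⟩ := hΦ k hk
        exact ⟨c, fun _ => hc⟩
      · exact ⟨0, fun h => absurd h hk⟩
  choose c hc using hex
  let ℓ : Fin m → MvPolynomial (Fin m) ℂ := fun a =>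
    ∑ b, MvPolynomial.C (Q (EuclideanSpace.single b 1) a) * MvPolynomial.X b
  let P : ℕ → Fin m → MvPolynomial (Fin m) ℂ := fun k i =>
    ∑ I : Fin k → Fin m, MvPolynomial.C (S (c k I) i) * ∏ j, ℓ (I j)
  have hℓ : ∀ a, (ℓ a).IsHomogeneous 1 := fun a =>
    MvPolynomial.IsHomogeneous.sum _ _ _ fun b _ => (MvPolynomial.isHomogeneous_X ℂ b).C_mul _
  have hℓe : ∀ (y : Cspace m) a, MvPolynomial.eval (fun j => y j) (ℓ a) = Q y a := fun y a => by
    conv_rhs => rw [← (EuclideanSpace.basisFun (Fin m) ℂ).sum_repr y]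
    simp [ℓ, map_sum, mul_comm]
  have hP : ∀ k i, (P k i).IsHomogeneous k := fun k i =>
    MvPolynomial.IsHomogeneous.sum _ _ _ fun I _ => by
      have := MvPolynomial.IsHomogeneous.prod (Finset.univ : Finset (Fin k)) (fun j => ℓ (I j))
        (fun _ => 1) fun j _ => hℓ (I j)
      simp only [Finset.sum_const, Finset.card_univ, Fintype.card_fin, smul_eq_mul, mul_one] at this
      exact this.C_mul _
  refine ⟨fun i => ∑ k ∈ Finset.Icc 2 p, P k i, fun i d hd => ?_, fun y i => ?_⟩
  · rw [MvPolynomial.mem_support_iff, MvPolynomial.coeff_sum] at hd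
    obtain ⟨k, hk, hne⟩ := Finset.exists_ne_zero_of_sum_ne_zero hd
    have hdeg : d.degree = k := by
      by_contra h
      exact hne ((hP k i).coeff_eq_zero h)
    rw [hdeg]
    exact Finset.mem_Icc.1 hk
  · simp only
    rw [hu, map_sum, map_sum, WithLp.ofLp_sum, Finset.sum_apply]
    refine Finset.sum_congr rfl fun k hk => ?_
    rw [hc k hk, Tensor.toML_apply]
    simp only [P, map_sum, map_mul, map_prod, MvPolynomial.eval_C, hℓe, map_smul,
      WithLp.ofLp_sum, Finset.sum_apply, PiLp.smul_apply, smul_eq_mul]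
    exact Finset.sum_congr rfl fun I _ => mul_comm _ _

/-! ### From infinitesimal commutation to commutation with the flow -/

section Flow

variable {E : Type*} [NormedAddCommGroup E] [NormedSpace ℂ E]

theorem fderiv_conj {g : E → E} (hg : Differentiable ℂ g) (Q : E ≃L[ℂ] E) (y v : E) :
    fderiv ℂ (fun z => Q.symm (g (Q z))) y v = Q.symm (fderiv ℂ g (Q y) (Q v)) := by
  have h1 : HasFDerivAt (fun z => Q.symm (g (Q z)))
      ((Q.symm : E →L[ℂ] E) ∘L (fderiv ℂ g (Q y)) ∘L (Q : E →L[ℂ] E)) y :=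
    Q.symm.hasFDerivAt.comp y ((hg _).hasFDerivAt.comp y Q.hasFDerivAt)
  rw [h1.fderiv]
  rfl

variable [CompleteSpace E]

/-- A map commuting infinitesimally with a linear vector field commutes with its flow. -/
theorem apply_exp_smul_of_fderiv {R : E → E} (hR : Differentiable ℂ R)
    {B : E →L[ℂ] E} (h : ∀ y, fderiv ℂ R y (B y) = B (R y)) (t : ℂ) (y : E) :
    R (NormedSpace.exp (t • B) y) = NormedSpace.exp (t • B) (R y) := by
  let := NormedAlgebra.restrictScalars ℚ ℂ (E →L[ℂ] E)
  have hinv : ∀ (t : ℂ) (z : E),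
      NormedSpace.exp (t • B) (NormedSpace.exp (-(t • B)) z) = z := fun t z => by
    have h1 := NormedSpace.exp_add_of_commute (x := t • B) (y := -(t • B))
      (Commute.neg_right (Commute.refl _))
    rw [add_neg_cancel, NormedSpace.exp_zero] at h1
    rw [← mul_apply_eq_comp, ← h1, one_apply_eq_self]
  have hd : ∀ t : ℂ, HasDerivAt (fun t : ℂ => NormedSpace.exp (t • B))
      (NormedSpace.exp (t • B) * B) t := fun t => hasDerivAt_exp_smul_const B t
  have hd' : ∀ t : ℂ, HasDerivAt (fun t : ℂ => NormedSpace.exp (t • B))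
      (B * NormedSpace.exp (t • B)) t := fun t => hasDerivAt_exp_smul_const' B t
  -- The two contributions cancel because `DR(z) B z = B R(z)` at `z = exp (t B) y`.
  have hg : ∀ t : ℂ, HasDerivAt (fun t : ℂ => NormedSpace.exp (-(t • B))
      (R (NormedSpace.exp (t • B) y))) 0 t := by
    intro t
    have h1 : HasDerivAt (fun t : ℂ => NormedSpace.exp (t • B) y)
        ((B * NormedSpace.exp (t • B)) y) t := by
      simpa using (hd' t).clm_apply (hasDerivAt_const t y)
    have h2 := (hR (NormedSpace.exp (t • B) y)).hasFDerivAt.comp_hasDerivAt t h1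
    have h3 : HasDerivAt (fun t : ℂ => NormedSpace.exp (-(t • B)))
        (-(NormedSpace.exp (-(t • B)) * B)) t := by
      have := (hd (-t)).scomp t (hasDerivAt_neg t)
      simpa only [Function.comp_def, neg_smul, one_smul] using this
    have h4 := h3.clm_apply h2
    convert! h4 using 1
    rw [mul_apply_eq_comp, h]
    simp
  have hconst := is_const_of_deriv_eq_zero (fun t => (hg t).differentiableAt)
    (fun t => (hg t).deriv) t 0
  have hconst' : NormedSpace.exp (-(t • B)) (R (NormedSpace.exp (t • B) y)) = R y := by
    simpa using hconst
  rw [← hconst', hinv]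

theorem conj_apply_exp_smul {R : E → E} (hR : Differentiable ℂ R) {B B' : E →L[ℂ] E}
    (h : ∀ y, fderiv ℂ R y (B y) = B (R y)) (Q : E ≃L[ℂ] E)
    (hB' : B' = (Q.symm : E →L[ℂ] E) ∘L B ∘L (Q : E →L[ℂ] E)) (t : ℂ) (y : E) :
    Q.symm (R (Q (NormedSpace.exp (t • B') y))) =
      NormedSpace.exp (t • B') (Q.symm (R (Q y))) := by
  have h1 : ∀ y, HasFDerivAt (fun y => Q.symm (R (Q y)))
      ((Q.symm : E →L[ℂ] E) ∘L (fderiv ℂ R (Q y)) ∘L (Q : E →L[ℂ] E)) y := fun y =>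
    Q.symm.hasFDerivAt.comp y ((hR _).hasFDerivAt.comp y Q.hasFDerivAt)
  refine apply_exp_smul_of_fderiv (R := fun y => Q.symm (R (Q y)))
    (fun y => (h1 y).differentiableAt) (fun y => ?_) t y
  rw [(h1 y).fderiv, hB']
  simp [h]

end Flow

/-! ### Constants and transport to the original coordinates -/

theorem constM0_pos : 0 < constM0 := by
  -- This holds without checking that the supremum is finite, since an unbounded real supremum has
  -- the value `0`; the other summand of `constM0` gives strict positivity.
  have hnu : 0 ≤ nu := Real.iSup_nonneg fun p => by positivity
  unfold constM0
  positivity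

/-- The majorant needs only the factor `4`; having `9/2` leaves room to enlarge the radius by
`11/10`. With `s = √m ≥ 1` the comparison reduces to `s (s - 1) (5 s / 2 - 2) ≥ 0`. -/
theorem constC_gt {m : ℕ} (hm : 0 < m) {c ρ q q' : ℝ} (hc : 0 < c) (hρ : 0 < ρ) (hq : 0 < q)
    (hq' : 0 < q') : 9 / 2 * (m * (q * c) * (q' / ρ) ^ 2) * q < constC m c ρ q q' := by
  have hm1 : (1 : ℝ) ≤ m := by exact_mod_cast hm
  have hs1 : 1 ≤ Real.sqrt m := Real.one_le_sqrt.2 hm1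
  have hs2 : Real.sqrt m ^ 2 = m := Real.sq_sqrt (by linarith)
  set s := Real.sqrt m with hs
  have h1 : 9 / 2 * s ^ 2 ≤ s * (5 / 2 * s ^ 2 + 2) := by
    nlinarith [mul_nonneg (mul_nonneg (by linarith : (0 : ℝ) ≤ s) (by linarith : 0 ≤ s - 1))
      (by linarith : 0 ≤ 5 / 2 * s - 2)]
  have h2 : 0 < c * q ^ 2 * q' ^ 2 / ρ ^ 2 := by positivity
  have h3 : 0 < s * (3 * ρ * q * q') / ρ ^ 2 := by positivity
  have h4 := mul_le_mul_of_nonneg_right h1 h2.le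
  unfold constC
  rw [← hs, ← hs2]
  calc 9 / 2 * (s ^ 2 * (q * c) * (q' / ρ) ^ 2) * q
      = 9 / 2 * s ^ 2 * (c * q ^ 2 * q' ^ 2 / ρ ^ 2) := by rw [div_pow]; ring
    _ < s * (5 / 2 * s ^ 2 + 2) * (c * q ^ 2 * q' ^ 2 / ρ ^ 2) +
        s * (3 * ρ * q * q') / ρ ^ 2 := by linarith
    _ = _ := by ring

/-- The exponentially small bound obtained from the order `⌊1 / (e C ε)⌋`. -/
theorem eventually_exponential_bound {C K M : ℝ} (hC : 0 < C) (hM : 0 < M) :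
    ∀ᶠ p : ℕ in atTop, ∀ ε : ℝ, 0 < ε → 1 / (Real.exp 1 * C * ε) < p + 1 →
      K * (10 / 11 * Real.exp (-1)) ^ (p + 1) ≤
        M * ε ^ 2 * Real.exp (-(1 / (Real.exp 1 * C)) / ε) := by
  have he := Real.exp_pos 1
  have ht : Tendsto (fun n : ℕ => K * (Real.exp 1 * C) ^ 2 * ((n : ℝ) ^ 2 * (10 / 11) ^ n))
      atTop (𝓝 0) := by
    simpa using (tendsto_pow_const_mul_const_pow_of_abs_lt_one 2
      (by rw [abs_of_pos] <;> norm_num : |(10 / 11 : ℝ)| < 1)).const_mul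
        (K * (Real.exp 1 * C) ^ 2)
  have hev := (ht.comp (tendsto_add_atTop_nat 1)).eventually_lt_const hM
  filter_upwards [hev] with p hp ε hε hpε
  simp only [Function.comp_apply, Nat.cast_add, Nat.cast_one] at hp
  have hn : (0 : ℝ) < p + 1 := by positivity
  have h1 : 1 < (p + 1) * (Real.exp 1 * C * ε) := by
    rwa [div_lt_iff₀ (by positivity)] at hpε
  have h2 : Real.exp (-1) ^ (p + 1) ≤ Real.exp (-(1 / (Real.exp 1 * C)) / ε) := by
    rw [← Real.exp_nat_mul]
    apply Real.exp_le_exp.2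
    rw [neg_div, div_div]
    push_cast
    linarith
  -- Since `ε > 1 / (e C (p + 1))`, the factor `ε²` decays at worst quadratically in `p`, and the
  -- geometric factor wins.
  have h3 : K * (10 / 11) ^ (p + 1) ≤ M * ε ^ 2 := by
    have h4 : 1 ≤ ((p + 1) * (Real.exp 1 * C * ε)) ^ 2 := one_le_pow₀ h1.le
    have h5 : M * 1 ≤ M * ((p + 1) * (Real.exp 1 * C * ε)) ^ 2 := by gcongr
    have h6 : K * (10 / 11) ^ (p + 1) * ((p + 1) * (Real.exp 1 * C)) ^ 2 ≤
        M * ε ^ 2 * ((p + 1) * (Real.exp 1 * C)) ^ 2 := by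
      nlinarith
    exact le_of_mul_le_mul_right h6 (by positivity)
  calc K * (10 / 11 * Real.exp (-1)) ^ (p + 1)
      = K * (10 / 11) ^ (p + 1) * Real.exp (-1) ^ (p + 1) := by rw [mul_pow]; ring
    _ ≤ M * ε ^ 2 * Real.exp (-(1 / (Real.exp 1 * C)) / ε) := by gcongr

/-- The normal forms of the vector field `Q ∘ X ∘ Q⁻¹`, whose linear part is standard nilpotent. -/
theorem IsStandardNilpotent.exists_conj_normalForm (hm : 0 < m) {N L : Cspace m →L[ℂ] Cspace m}
    (hN : IsStandardNilpotent N) {U : Set (Cspace m)} (hU : IsOpen U) (h0U : (0 : Cspace m) ∈ U)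
    {X : Cspace m → Cspace m} (hX : AnalyticOnNhd ℂ X U)
    {f : (δ : ℕ) → ContinuousMultilinearMap ℂ (fun _ : Fin δ => Cspace m) (Cspace m)}
    (hXf : ∀ᶠ x in 𝓝 (0 : Cspace m), HasSum (fun δ : ℕ => f (δ + 2) (fun _ => x)) (X x - L x))
    {c ρ : ℝ} (hc : 0 < c) (hρ : 0 < ρ)
    (hf : ∀ δ, 2 ≤ δ → ∀ x : Fin δ → Cspace m, ‖f δ x‖ ≤ c * (∏ i, ‖x i‖) / ρ ^ δ)
    (Q : Cspace m ≃L[ℂ] Cspace m)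
    (hQ : N = (Q : Cspace m →L[ℂ] Cspace m) ∘L L ∘L (Q.symm : Cspace m →L[ℂ] Cspace m))
    {C q q' : ℝ} (hC0 : 0 < C) (hq0 : 0 < q) (hq'0 : 0 < q') (hQle : ∀ x, ‖Q x‖ ≤ q * ‖x‖)
    (hQsle : ∀ x, ‖Q.symm x‖ ≤ q' * ‖x‖)
    (hCgt : 9 / 2 * (m * (q * c) * (q' / ρ) ^ 2) * q < C) :
    ∃ u R T : ℕ → Cspace m → Cspace m, ∃ K : ℝ, 0 < K ∧ ∀ᶠ p : ℕ in atTop,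
      IsHomSum p (u p) ∧ IsHomSum p (R p) ∧
      Set.InjOn (fun y => y + u p y) (Metric.ball 0 (11 / 10 * q / C / p)) ∧
      Set.MapsTo (fun y => y + u p y) (Metric.ball 0 (11 / 10 * q / C / p)) (Q.symm ⁻¹' U) ∧
      (∀ y ∈ Metric.ball (0 : Cspace m) (11 / 10 * q / C / p),
        (fderiv ℂ (fun z => z + u p z) y).IsInvertible) ∧
      AnalyticOnNhd ℂ (T p) (Metric.ball 0 (11 / 10 * q / C / p)) ∧
      (∀ y ∈ Metric.ball (0 : Cspace m) (11 / 10 * q / C / p),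
        fderiv ℂ (fun z => z + u p z) y (N y + R p y + T p y) =
          Q (X (Q.symm (y + u p y)))) ∧
      (∀ y ∈ Metric.ball (0 : Cspace m) (11 / 10 * q / C / p),
        ‖T p y‖ ≤ K * (‖y‖ / (11 / 10 * q / C / p)) ^ (p + 1)) ∧
      ∀ y, fderiv ℂ (R p) y (ContinuousLinearMap.adjoint N y) =
        ContinuousLinearMap.adjoint N (R p y) := by
  have hm' : (0 : ℝ) < m := by exact_mod_cast hm
  exact hN.exists_normalForm hm
    (f := fun δ => (Q : Cspace m →L[ℂ] Cspace m).compContinuousMultilinearMap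
      ((f δ).compContinuousLinearMap fun _ =>
        (Q.symm : Cspace m →L[ℂ] Cspace m)))
    (a := q' / ρ) (c := q * c) (by positivity) (by positivity) (X := fun x => Q (X (Q.symm x)))
    (U := Q.symm ⁻¹' U) (τ := 11 / 10 * q / C)
    (by
      intro δ hδ x
      calc ‖Q (f δ fun i => Q.symm (x i))‖ ≤ q * (c * (∏ i, (q' * ‖x i‖)) / ρ ^ δ) := by
            refine (hQle _).trans (mul_le_mul_of_nonneg_left ((hf δ hδ _).trans ?_) hq0.le)
            gcongr with i
            exact hQsle _
        _ = _ := by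
            rw [Finset.prod_mul_distrib]
            simp only [Finset.prod_const, Finset.card_univ, Fintype.card_fin]
            rw [div_pow]; ring)
    (hU.preimage Q.symm.continuous) (by simpa using h0U)
    (fun x hx => ((Q : Cspace m →L[ℂ] Cspace m).analyticAt _).comp
      (AnalyticAt.comp (hX _ hx)
        ((Q.symm : Cspace m →L[ℂ] Cspace m).analyticAt x)))
    (by
      have ht : Tendsto Q.symm (𝓝 0) (𝓝 0) := by
        simpa using Q.symm.continuous.tendsto 0
      filter_upwards [ht.eventually hXf] with x hx
      have := (Q : Cspace m →L[ℂ] Cspace m).hasSum hx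
      convert! this using 1
      rw [hQ]; simp)
    (by positivity)
    (by
      -- Conjugation turns the bounds into `q c` and `a = q' / ρ`; the condition on `τ` holds
      -- because `4 · 11/10 < 9/2`.
      rw [show 4 * (m * (q * c) * (q' / ρ) ^ 2) * (11 / 10 * q / C) =
        (44 / 10 * (m * (q * c) * (q' / ρ) ^ 2) * q) / C by ring, div_lt_one hC0]
      have : 0 < m * (q * c) * (q' / ρ) ^ 2 * q := by positivity
      linarith)

/-- Transport of a normal form by the linear change of coordinates `Q`. -/
theorem normalForm_conj {N L : Cspace m →L[ℂ] Cspace m} {Q : Cspace m ≃L[ℂ] Cspace m}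
    (hNQ : ∀ y, N (Q y) = Q (L y)) {X : Cspace m → Cspace m} {U : Set (Cspace m)}
    {u R T : Cspace m → Cspace m} (hu : Differentiable ℂ u) {q q' r K : ℝ} {p : ℕ} (hq0 : 0 < q)
    (hq'0 : 0 < q') (hQle : ∀ x, ‖Q x‖ ≤ q * ‖x‖) (hQsle : ∀ x, ‖Q.symm x‖ ≤ q' * ‖x‖)
    (hr0 : 0 < r) (hK : 0 ≤ K)
    (hinj : Set.InjOn (fun y => y + u y) (Metric.ball 0 r))
    (hmaps : Set.MapsTo (fun y => y + u y) (Metric.ball 0 r) (Q.symm ⁻¹' U))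
    (hinvt : ∀ y ∈ Metric.ball (0 : Cspace m) r, (fderiv ℂ (fun z => z + u z) y).IsInvertible)
    (hTan : AnalyticOnNhd ℂ T (Metric.ball 0 r))
    (heq : ∀ y ∈ Metric.ball (0 : Cspace m) r,
      fderiv ℂ (fun z => z + u z) y (N y + R y + T y) = Q (X (Q.symm (y + u y))))
    (hTb : ∀ y ∈ Metric.ball (0 : Cspace m) r, ‖T y‖ ≤ K * (‖y‖ / r) ^ (p + 1)) :
    Set.InjOn (fun y => y + Q.symm (u (Q y))) (Metric.ball 0 (r / q)) ∧
    Set.MapsTo (fun y => y + Q.symm (u (Q y))) (Metric.ball 0 (r / q)) U ∧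
    (∀ y ∈ Metric.ball (0 : Cspace m) (r / q),
      (fderiv ℂ (fun z => z + Q.symm (u (Q z))) y).IsInvertible) ∧
    AnalyticOnNhd ℂ (fun y => Q.symm (T (Q y))) (Metric.ball 0 (r / q)) ∧
    (∀ y ∈ Metric.ball (0 : Cspace m) (r / q), fderiv ℂ (fun z => z + Q.symm (u (Q z))) y
      (L y + Q.symm (R (Q y)) + Q.symm (T (Q y))) = X (y + Q.symm (u (Q y)))) ∧
    ∀ y ∈ Metric.ball (0 : Cspace m) (r / q),
      ‖Q.symm (T (Q y))‖ ≤ q' * K * (‖y‖ / (r / q)) ^ (p + 1) := by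
  have hQball : ∀ y ∈ Metric.ball (0 : Cspace m) (r / q),
      Q y ∈ Metric.ball (0 : Cspace m) r := fun y hy => by
    rw [mem_ball_zero_iff] at hy ⊢
    rw [lt_div_iff₀ hq0] at hy
    linarith [hQle y]
  have hid : ∀ y, y + Q.symm (u (Q y)) = Q.symm (Q y + u (Q y)) := fun y => by simp
  have hfd : ∀ y v, fderiv ℂ (fun z => z + Q.symm (u (Q z))) y v =
      Q.symm (fderiv ℂ (fun z => z + u z) (Q y) (Q v)) := fun y v => by
    simp only [hid]
    exact fderiv_conj (differentiable_id.fun_add hu) Q y v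
  refine ⟨fun y hy z hz hyz => ?_, fun y hy => ?_, fun y hy => ?_, fun y hy => ?_, fun y hy => ?_,
    fun y hy => ?_⟩
  · simp only [hid] at hyz
    exact Q.injective (hinj (hQball y hy) (hQball z hz) (Q.symm.injective hyz))
  · simp only [hid]
    exact hmaps (hQball y hy)
  · obtain ⟨A, hA⟩ := hinvt _ (hQball y hy)
    refine ⟨(Q.trans A).trans Q.symm, ?_⟩
    ext1 v
    rw [hfd, ← hA]
    rfl
  · exact ((Q.symm : Cspace m →L[ℂ] Cspace m).analyticAt _).comp
      (AnalyticAt.comp (hTan _ (hQball y hy)) ((Q : Cspace m →L[ℂ] Cspace m).analyticAt y))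
  · have e : Q (L y + Q.symm (R (Q y)) + Q.symm (T (Q y))) = N (Q y) + R (Q y) + T (Q y) := by
      simp [hNQ]
    rw [hfd, e, heq _ (hQball y hy), hid, Q.symm_apply_apply]
  · calc ‖Q.symm (T (Q y))‖ ≤ q' * (K * (‖Q y‖ / r) ^ (p + 1)) :=
          (hQsle _).trans (mul_le_mul_of_nonneg_left (hTb _ (hQball y hy)) hq'0.le)
      _ ≤ q' * (K * (q * ‖y‖ / r) ^ (p + 1)) := by
          gcongr
          exact hQle y
      _ = _ := by
          have e : q * ‖y‖ / r = ‖y‖ / (r / q) := by rw [div_div_eq_mul_div, mul_comm]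
          rw [e, mul_assoc]

end NilpotentNF

end

/-! ### The optimal order of truncation -/

theorem theorem2 (m : ℕ) (hm : 0 < m)
    -- an analytic vector field `X` on a neighbourhood `U` of `0`, vanishing at `0`
    (U : Set (NilpotentNF.Cspace m)) (hU : IsOpen U) (h0U : (0 : NilpotentNF.Cspace m) ∈ U)
    (X : NilpotentNF.Cspace m → NilpotentNF.Cspace m)
    (hX : AnalyticOnNhd ℂ X U) (hX0 : X 0 = 0)
    -- its expansion `X = L + ∑_{δ ≥ 2} f_δ` near `0`
    (L : NilpotentNF.Cspace m →L[ℂ] NilpotentNF.Cspace m) (hL : IsNilpotent L)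
    (f : (δ : ℕ) → ContinuousMultilinearMap ℂ
      (fun _ : Fin δ => NilpotentNF.Cspace m) (NilpotentNF.Cspace m))
    (hfsymm : ∀ δ, 2 ≤ δ → ∀ (σ : Equiv.Perm (Fin δ)) (x : Fin δ → NilpotentNF.Cspace m),
      f δ (fun i => x (σ i)) = f δ x)
    (hXf : ∀ᶠ x in 𝓝 (0 : NilpotentNF.Cspace m),
      HasSum (fun δ : ℕ => f (δ + 2) (fun _ => x)) (X x - L x))
    (c ρ : ℝ) (hc : 0 < c) (hρ : 0 < ρ)
    (hf : ∀ δ, 2 ≤ δ → ∀ x : Fin δ → NilpotentNF.Cspace m,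
      ‖f δ x‖ ≤ c * (∏ i, ‖x i‖) / ρ ^ δ)
    -- an invertible `Q` bringing `L` to the standard nilpotent form `N = Q L Q⁻¹`
    (Q : NilpotentNF.Cspace m ≃L[ℂ] NilpotentNF.Cspace m)
    (N : NilpotentNF.Cspace m →L[ℂ] NilpotentNF.Cspace m)
    (hN : NilpotentNF.IsStandardNilpotent N)
    (hQ : N = (Q : NilpotentNF.Cspace m →L[ℂ] NilpotentNF.Cspace m) ∘L L ∘L
      (Q.symm : NilpotentNF.Cspace m →L[ℂ] NilpotentNF.Cspace m))
    (Lbar : NilpotentNF.Cspace m →L[ℂ] NilpotentNF.Cspace m)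
    (hLbar : Lbar = (Q.symm : NilpotentNF.Cspace m →L[ℂ] NilpotentNF.Cspace m) ∘L
      (ContinuousLinearMap.adjoint N) ∘L
      (Q : NilpotentNF.Cspace m →L[ℂ] NilpotentNF.Cspace m))
    (C w : ℝ)
    (hC : C = NilpotentNF.constC m c ρ
      ‖(Q : NilpotentNF.Cspace m →L[ℂ] NilpotentNF.Cspace m)‖
      ‖(Q.symm : NilpotentNF.Cspace m →L[ℂ] NilpotentNF.Cspace m)‖)
    (hw : w = 1 / (Real.exp 1 * C)) :
    -- maps `u_p`, `R_p`, `T_p`, depending on the order `p` of truncation only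
    ∃ u R T : ℕ → NilpotentNF.Cspace m → NilpotentNF.Cspace m,
    ∃ ε₀ : ℝ, 0 < ε₀ ∧ ∀ ε : ℝ, 0 < ε → ε < ε₀ →
      ∀ p : ℕ, p = ⌊1 / (Real.exp 1 * C * ε)⌋₊ →
        NilpotentNF.IsPolyMap 2 p (u p) ∧
        NilpotentNF.IsPolyMap 2 p (R p) ∧
        (∃ r : ℝ, ε < r ∧
          -- `id + u_p` is a coordinate transformation from the ball of radius `r` into `U`
          Set.InjOn (fun y => y + u p y) (Metric.ball 0 r) ∧
          Set.MapsTo (fun y => y + u p y) (Metric.ball 0 r) U ∧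
          (∀ y ∈ Metric.ball (0 : NilpotentNF.Cspace m) r,
            (fderiv ℂ (fun z => z + u p z) y).IsInvertible) ∧
          AnalyticOnNhd ℂ (T p) (Metric.ball 0 r) ∧
          -- in the coordinates `y`, `x = y + u_p(y)`, the vector field is `L + R_p + T_p`
          (∀ y ∈ Metric.ball (0 : NilpotentNF.Cspace m) r,
            fderiv ℂ (fun z => z + u p z) y (L y + R p y + T p y) = X (y + u p y))) ∧
        (T p =O[𝓝 0] fun y => ‖y‖ ^ (p + 1)) ∧
        (∀ y, ‖y‖ ≤ ε → ‖T p y‖ ≤ NilpotentNF.constM0 * ε ^ 2 * Real.exp (-w / ε)) ∧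
        (∀ (t : ℂ) (y : NilpotentNF.Cspace m),
          R p (NormedSpace.exp (t • Lbar) y) = NormedSpace.exp (t • Lbar) (R p y)) := by
  classical
  have : Nontrivial (NilpotentNF.Cspace m) := by
    have : Nonempty (Fin m) := ⟨⟨0, hm⟩⟩
    infer_instance
  set q := ‖(Q : NilpotentNF.Cspace m →L[ℂ] NilpotentNF.Cspace m)‖ with hq
  set q' := ‖(Q.symm : NilpotentNF.Cspace m →L[ℂ] NilpotentNF.Cspace m)‖ with hq'
  have hq0 : 0 < q := Q.norm_pos
  have hq'0 : 0 < q' := Q.symm.norm_pos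
  have hQle : ∀ x, ‖Q x‖ ≤ q * ‖x‖ := fun x =>
    (Q : NilpotentNF.Cspace m →L[ℂ] NilpotentNF.Cspace m).le_opNorm x
  have hQsle : ∀ x, ‖Q.symm x‖ ≤ q' * ‖x‖ := fun x =>
    (Q.symm : NilpotentNF.Cspace m →L[ℂ] NilpotentNF.Cspace m).le_opNorm x
  have hNQ : ∀ y, N (Q y) = Q (L y) := fun y => by rw [hQ]; simp
  have hCgt := NilpotentNF.constC_gt hm hc hρ hq0 hq'0
  rw [← hC] at hCgt
  have hm' : (0 : ℝ) < m := by exact_mod_cast hm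
  have hC0 : 0 < C := lt_trans (by positivity) hCgt
  obtain ⟨u, R, T, K, hK, hev⟩ := hN.exists_conj_normalForm hm hU h0U hX hXf hc hρ hf Q hQ hC0
    hq0 hq'0 hQle hQsle hCgt
  have hexp := NilpotentNF.eventually_exponential_bound (K := q' * K) hC0
    NilpotentNF.constM0_pos
  obtain ⟨p₀, hp₀⟩ := eventually_atTop.1 ((hev.and hexp).and (eventually_ge_atTop 1))
  have he := Real.exp_pos 1
  -- The threshold makes `1 / (e C ε) > p₀ + 1`, so that the optimal order is at least `p₀`.
  refine ⟨fun p y => Q.symm (u p (Q y)), fun p y => Q.symm (R p (Q y)),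
    fun p y => Q.symm (T p (Q y)), 1 / (Real.exp 1 * C * (p₀ + 1)), by positivity, ?_⟩
  intro ε hε hεlt p hp
  have hE : 0 < Real.exp 1 * C * ε := by positivity
  have hple : (p : ℝ) ≤ 1 / (Real.exp 1 * C * ε) := by
    rw [hp]; exact Nat.floor_le (by positivity)
  have hplt : 1 / (Real.exp 1 * C * ε) < p + 1 := by
    rw [hp]; exact Nat.lt_floor_add_one _
  have hpp₀ : p₀ ≤ p := by
    rw [hp]
    refine Nat.le_floor ?_
    rw [lt_div_iff₀ (by positivity)] at hεlt
    rw [le_div_iff₀ hE]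
    nlinarith
  obtain ⟨⟨⟨hu, hR, hinj, hmaps, hinvt, hTan, heq, hTb, hadj⟩, hbound⟩, hp1⟩ := hp₀ p hpp₀
  have hp0 : (0 : ℝ) < p := by exact_mod_cast hp1
  set r' := 11 / 10 * q / C / (p : ℝ) with hr'
  have hr'0 : 0 < r' := by positivity
  clear_value r'
  obtain ⟨hinj', hmaps', hinvt', hTan', heq', hTle⟩ := NilpotentNF.normalForm_conj hNQ
    (fun y => (hu.analyticAt y).differentiableAt) hq0 hq'0 hQle hQsle hr'0 hK.le hinj hmaps hinvt
    hTan heq hTb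
  -- Here `r' / q = 11 / (10 C p)`, and `p ≤ 1 / (e C ε)`.
  have hεr : 11 / 10 * Real.exp 1 * ε ≤ r' / q := by
    rw [hr', le_div_iff₀ hq0, le_div_iff₀ hp0, le_div_iff₀ hC0]
    rw [le_div_iff₀ hE] at hple
    nlinarith
  have he1 : 1 < Real.exp 1 := by
    have := Real.add_one_lt_exp (one_ne_zero); linarith
  have hεr' : ε < r' / q := by nlinarith
  have hr'q : 0 < r' / q := by positivity
  refine ⟨hu.isPolyMap_conj (Q.symm : NilpotentNF.Cspace m →L[ℂ] NilpotentNF.Cspace m)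
      (Q : NilpotentNF.Cspace m →L[ℂ] NilpotentNF.Cspace m),
    hR.isPolyMap_conj (Q.symm : NilpotentNF.Cspace m →L[ℂ] NilpotentNF.Cspace m)
      (Q : NilpotentNF.Cspace m →L[ℂ] NilpotentNF.Cspace m),
    ⟨r' / q, hεr', hinj', hmaps', hinvt', hTan', heq'⟩, ?_, ?_,
    NilpotentNF.conj_apply_exp_smul (fun y => (hR.analyticAt y).differentiableAt) hadj Q hLbar⟩
  · refine Asymptotics.IsBigO.of_bound (q' * K * (1 / (r' / q)) ^ (p + 1)) ?_
    filter_upwards [Metric.ball_mem_nhds (0 : NilpotentNF.Cspace m) hr'q] with y hy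
    refine (hTle y hy).trans (le_of_eq ?_)
    rw [norm_pow, norm_norm, div_eq_mul_one_div, mul_pow]; ring
  · intro y hy
    rw [hw]
    refine (hTle y (mem_ball_zero_iff.2 (hy.trans_lt hεr'))).trans
      (le_trans ?_ (hbound ε hε hplt))
    have h1 : ‖y‖ / (r' / q) ≤ 10 / 11 * Real.exp (-1) := by
      rw [div_le_iff₀ hr'q, Real.exp_neg]
      calc ‖y‖ ≤ ε := hy
        _ = 10 / 11 * (Real.exp 1)⁻¹ * (11 / 10 * Real.exp 1 * ε) := by field_simp
        _ ≤ _ := mul_le_mul_of_nonneg_left hεr (by positivity)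
    exact mul_le_mul_of_nonneg_left (pow_le_pow_left₀ (by positivity) h1 _) (by positivity)
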